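/- Let $n, N \ge 1$ and let $S_1,\dots,S_N:\mathbb{R}^n\to\mathbb{R}^n$ be contracting invertible affine maps, i.e. $S_i(x)=A_ix+b_i$ with $A_i\in \mathrm{GL}(n,\mathbb{R})$, $b_i\in\mathbb{R}^n$, and for each $i$ there is $c_i\in(0,1)$ with $|S_i(x)-S_i(y)|\le c_i|x-y|$ for all $x,y$ (Euclidean norm). For a compact set $C\subset\mathbb{R}^n$ let $F_C$ be the inhomogeneous self-affine set with condensation set $C$, i.e. the unique non-empty compact set with $$F_C=\bigcup_{i=1}^N S_i(F_C)\cup C,$$ so that $F_\emptyset$ is the homogeneous attractor. For bounded $F\subset\mathbb{R}^n$ let $\overline{\dim}_{\mathrm B}F=\limsup_{\delta\to0^+}\frac{\log N_\delta(F)}{-\log\delta}$, where $N_\delta(F)$ is the minimum number of hypercubes of sidelength $\delta$ required to cover $F$ (and $\overline{\dim}_{\mathrm B}\emptyset=0$). For an invertible linear map $A$ of $\mathbb{R}^n$ with singular values $\alpha_1\ge\dots\ge\alpha_n>0$ put $\phi^0(A)=1$, $\phi^t(A)=\alpha_1\cdots\alpha_{m-1}\,\alpha_m^{\,t-m+1}$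 for $0<t\le n$, where $m\in\mathbb{Z}$ satisfies $m-1<t\le m$, and $\phi^t(A)=|\det A|^{t/n}$ for $t>n$. For an affine map, $\phi^t$ is that of its linear part. For $k\ge1$ let $s_k\ge0$ be the solution of $$\sum_{(i_1,\dots,i_k)\in\{1,\dots,N\}^k}\phi^{s_k}(S_{i_1}\circ\cdots\circ S_{i_k})=1,$$ and let $s=\lim_{k\to\infty}s_k$ be the affinity dimension. Then $s$ is well defined (for each $k\ge1$ there is exactly one solution $s_k\ge 0$, and the sequence $(s_k)$ converges to a real number), and for every compact $C\subset\mathbb{R}^n$: 1. if $\overline{\dim}_{\mathrm B}F_\emptyset=s$, then $\overline{\dim}_{\mathrm B}F_C=\max\{\overline{\dim}_{\mathrm B}F_\emptyset,\ \overline{\dim}_{\mathrm B}C\}$; 2. if $\overline{\dim}_{\mathrm B}C\ge s$, then $\overline{\dim}_{\mathrm B}F_C=\overline{\dim}_{\mathrm B}C$. -/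

import Mathlib

open Filter Topology TopologicalSpace

/-- A (closed, arbitrarily oriented) hypercube of sidelength `δ` in `ℝⁿ`: the image of `[0, δ]ⁿ`
under an isometry of `ℝⁿ`. -/
def IsHypercube {n : ℕ} (δ : ℝ) (Q : Set (EuclideanSpace ℝ (Fin n))) : Prop :=
  ∃ g : EuclideanSpace ℝ (Fin n) ≃ᵢ EuclideanSpace ℝ (Fin n),
    Q = g '' {x | ∀ i, x i ∈ Set.Icc 0 δ}

/-- `N_δ(F)`: the minimum number of hypercubes of sidelength `δ` required to cover `F`.
(For bounded `F` and `δ > 0` such a finite cover exists.) -/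
noncomputable def cubeCoveringNumber {n : ℕ} (δ : ℝ) (F : Set (EuclideanSpace ℝ (Fin n))) : ℕ :=
  sInf {k : ℕ | ∃ Q : Fin k → Set (EuclideanSpace ℝ (Fin n)),
    (∀ j, IsHypercube δ (Q j)) ∧ F ⊆ ⋃ j, Q j}

/-- The upper box dimension `limsup_{δ → 0⁺} log N_δ(F) / (-log δ)` of a bounded set, as an extended
real number, so that the limsup is never a default value. The empty set gets the value `0`. -/
noncomputable def upperBoxDim {n : ℕ} (F : Set (EuclideanSpace ℝ (Fin n))) : EReal :=
  limsup (fun δ : ℝ => ((Real.log (cubeCoveringNumber δ F) / (-Real.log δ) : ℝ) : EReal)) (𝓝[>] 0)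

/-- The singular value function `φᵗ(T)`, for `t ≥ 0`: with `α₁ ≥ ⋯ ≥ αₙ` the singular values of `T`
and `m - 1 < t ≤ m`, it is `α₁ ⋯ αₘ₋₁ αₘ ^ (t - m + 1)` if `t ≤ n`, and it is `|det T| ^ (t / n)`
if `t > n`. Mathlib indexes singular values from `0`, so that `αⱼ` is `T.singularValues (j - 1)`;
the natural number `⌈t⌉₊ - 1` is `m - 1` for `t > 0`, while for `t = 0` the formula gives the
usual value `φ⁰ = 1`. -/
noncomputable def singularValueFunction {n : ℕ} (t : ℝ)
    (T : EuclideanSpace ℝ (Fin n) →ₗ[ℝ] EuclideanSpace ℝ (Fin n)) : ℝ :=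
  if t ≤ n then
    (∏ j ∈ Finset.range (⌈t⌉₊ - 1), T.singularValues j) *
      T.singularValues (⌈t⌉₊ - 1) ^ (t - ((⌈t⌉₊ - 1 : ℕ) : ℝ))
  else |LinearMap.det T| ^ (t / n)

/-- An affine iterated function system on `ℝⁿ`: `N` invertible affine maps, each of them
contracting. -/
structure AffineIFS (n N : ℕ) where
  /-- The maps `S₁, …, S_N`. -/
  map : Fin N → EuclideanSpace ℝ (Fin n) ≃ᵃ[ℝ] EuclideanSpace ℝ (Fin n)
  contracting : ∀ i, ∃ c : ℝ, 0 < c ∧ c < 1 ∧ ∀ x y, dist (map i x) (map i y) ≤ c * dist x y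

namespace AffineIFS

variable {n N : ℕ}

/-- The composition `S_{w₁} ∘ ⋯ ∘ S_{w_k}` along a word `w` of length `k`. -/
noncomputable def wordMap (S : AffineIFS n N) {k : ℕ} (w : Fin k → Fin N) :
    EuclideanSpace ℝ (Fin n) ≃ᵃ[ℝ] EuclideanSpace ℝ (Fin n) :=
  (List.ofFn fun j => S.map (w j)).prod

/-- The sum of `φᵗ(S_w)` over all words `w` of length `k`. -/
noncomputable def wordSum (S : AffineIFS n N) (k : ℕ) (t : ℝ) : ℝ :=
  ∑ w : Fin k → Fin N, singularValueFunction t (S.wordMap w).linear.toLinearMap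

/-- `s_k`: the solution `t ≥ 0` of `∑_{|w| = k} φᵗ(S_w) = 1`. -/
noncomputable def levelDimension (S : AffineIFS n N) (k : ℕ) : ℝ :=
  Classical.epsilon fun t : ℝ => 0 ≤ t ∧ S.wordSum k t = 1

/-- The affinity dimension `s = lim_{k → ∞} s_k`. -/
noncomputable def affinityDimension (S : AffineIFS n N) : ℝ :=
  limUnder atTop S.levelDimension

/-- `F` is an attractor of `S` with condensation set `C`: it is a non-empty compact set with
`F = ⋃ i, S_i(F) ∪ C`. -/
def IsAttractor (S : AffineIFS n N) (C F : Set (EuclideanSpace ℝ (Fin n))) : Prop :=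
  F.Nonempty ∧ IsCompact F ∧ F = (⋃ i, S.map i '' F) ∪ C

theorem existsUnique_isAttractor [NeZero N] (S : AffineIFS n N)
    (C : Compacts (EuclideanSpace ℝ (Fin n))) :
    ∃! F : Set (EuclideanSpace ℝ (Fin n)), S.IsAttractor C F := by
  choose c hc0 hc1 hc using S.contracting
  have hcont : ∀ i, Continuous (S.map i) := fun i =>
    (S.map i).toAffineMap.continuous_of_finiteDimensional
  let K : NNReal := Finset.univ.sup fun i => (c i).toNNReal
  have hK1 : K < 1 := by
    refine (Finset.sup_lt_iff (by simp)).2 fun i _ => ?_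
    simpa using hc1 i
  have hK : ∀ i x y, edist (S.map i x) (S.map i y) ≤ K * edist x y := by
    intro i x y
    have hle : (c i).toNNReal ≤ K :=
      Finset.le_sup (f := fun i => (c i).toNNReal) (Finset.mem_univ i)
    have hl : LipschitzWith (c i).toNNReal (S.map i) := LipschitzWith.of_dist_le_mul fun x y => by
      simpa [Real.coe_toNNReal _ (hc0 i).le] using hc i x y
    exact (hl x y).trans (by gcongr)
  let T : NonemptyCompacts (EuclideanSpace ℝ (Fin n)) →
      NonemptyCompacts (EuclideanSpace ℝ (Fin n)) := fun A =>
    { carrier := (⋃ i, S.map i '' A) ∪ C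
      isCompact' := (isCompact_iUnion fun i => A.isCompact.image (hcont i)).union C.isCompact
      nonempty' := by
        obtain ⟨x, hx⟩ := A.nonempty
        exact ⟨S.map 0 x, Or.inl (Set.mem_iUnion.2 ⟨0, x, hx, rfl⟩)⟩ }
  have key : ∀ A B : NonemptyCompacts (EuclideanSpace ℝ (Fin n)), ∀ x ∈ (T A : Set (EuclideanSpace ℝ (Fin n))),
      ∃ y ∈ (T B : Set (EuclideanSpace ℝ (Fin n))), edist x y ≤ K * edist A B := by
    rintro A B x (hx | hx)
    · obtain ⟨i, a, ha, rfl⟩ := Set.mem_iUnion.1 hx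
      obtain ⟨b, hb, hab⟩ := B.isCompact.exists_infEDist_eq_edist B.nonempty a
      refine ⟨S.map i b, Or.inl (Set.mem_iUnion.2 ⟨i, b, hb, rfl⟩), (hK i a b).trans ?_⟩
      rw [← hab]
      gcongr
      exact Metric.infEDist_le_hausdorffEDist_of_mem ha
    · exact ⟨x, Or.inr hx, by simp⟩
  have hT : ContractingWith K T := by
    refine ⟨hK1, fun A B => Metric.hausdorffEDist_le_of_mem_edist (key A B) fun x hx => ?_⟩
    rw [edist_comm A B]
    exact key B A x hx
  have : Nonempty (NonemptyCompacts (EuclideanSpace ℝ (Fin n))) := ⟨{0}⟩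
  refine ⟨(ContractingWith.fixedPoint T hT : NonemptyCompacts _), ⟨NonemptyCompacts.nonempty _,
    NonemptyCompacts.isCompact _, ?_⟩, ?_⟩
  · exact congrArg (fun A : NonemptyCompacts (EuclideanSpace ℝ (Fin n)) => (A : Set (EuclideanSpace ℝ (Fin n))))
      hT.fixedPoint_isFixedPt.symm
  · rintro F ⟨hne, hcpt, hF⟩
    have hfix : Function.IsFixedPt T ⟨⟨F, hcpt⟩, hne⟩ := NonemptyCompacts.ext hF.symm
    exact congrArg (fun A : NonemptyCompacts (EuclideanSpace ℝ (Fin n)) => (A : Set (EuclideanSpace ℝ (Fin n))))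
      (hT.fixedPoint_unique hfix)

/-- The inhomogeneous attractor `F_C`, for a compact condensation set `C` (possibly empty).
The homogeneous attractor `F_∅` is `S.attractor ⊥`. -/
noncomputable def attractor [NeZero N] (S : AffineIFS n N)
    (C : Compacts (EuclideanSpace ℝ (Fin n))) : Set (EuclideanSpace ℝ (Fin n)) :=
  (S.existsUnique_isAttractor C).choose

theorem isAttractor_attractor [NeZero N] (S : AffineIFS n N)
    (C : Compacts (EuclideanSpace ℝ (Fin n))) : S.IsAttractor C (S.attractor C) :=
  (S.existsUnique_isAttractor C).choose_spec.1

end AffineIFS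

/-! Since `F_C` contains both `C` and `F_∅`, monotonicity gives all lower bounds. Both claims then
follow from `IsAttractor.upperBoxDim_le_max`, that is `dim F_C ≤ max(s, dim C)`: the hypothesis of
each claim turns this maximum into the claimed value.

For the upper bound take `t > s` with `t > dim C`. By `exists_singularProd_mul_rpow_le` there is one
index `m < n` such that `α_0 ⋯ α_{m-1} α_m^(t-m) ≤ φ^t` for every injective linear map (singular
values indexed from `0`). At scale `δ`, follow each point of `F_C` through longer and longer words
`w` for as long as `α_m(w) ≥ δ`. Either the point falls into a copy `S_w(C)` on the way, or it lies
in a copy `S_w(F_C)` for the first word with `α_m(w) < δ`. One more letter shrinks `α_m` by a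
bounded factor only, so this last word still has `α_m(w) ≥ bδ`. In both cases the copy is covered by
a constant times `δ^(-t) φ^t(S_w)` balls of radius comparable to `δ` (`isBallCoverable_wordPiece`).
Summing over all words costs only a constant, because `∑_w φ^t(S_w)` converges for `t > s`
(`summable_wordSum`).

That convergence, and the existence of `s`, rest on submultiplicativity of `φ^t` up to a constant
(`singularValueFunction_comp_le`) and on Fekete's lemma. -/

/-! ### Singular values and products of the largest ones -/

theorem Finset.prod_le_prod_range_card_of_antitone {β : ℕ → ℝ} (hβ : Antitone β)
    (h0 : ∀ i, 0 ≤ β i) (s : Finset ℕ) : ∏ i ∈ s, β i ≤ ∏ i ∈ Finset.range s.card, β i := by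
  induction s using Finset.induction_on_max with
  | empty => simp
  | insert a s hs ih =>
    have ha : a ∉ s := fun h => lt_irrefl _ (hs a h)
    have hcard : s.card ≤ a := by
      simpa using Finset.card_le_card (fun x hx => Finset.mem_range.2 (hs x hx) : s ⊆ Finset.range a)
    rw [Finset.prod_insert ha, Finset.card_insert_of_notMem ha, Finset.prod_range_succ, mul_comm]
    exact mul_le_mul ih (hβ hcard) (h0 _) (Finset.prod_nonneg fun i _ => h0 i)

namespace LinearMap

variable {n : ℕ}

/-- The singular value decomposition of an injective endomorphism of `ℝⁿ`. -/
theorem exists_singular_bases {T : EuclideanSpace ℝ (Fin n) →ₗ[ℝ] EuclideanSpace ℝ (Fin n)}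
    (hT : Function.Injective T) :
    ∃ e f : OrthonormalBasis (Fin n) ℝ (EuclideanSpace ℝ (Fin n)),
      ∀ j : Fin n, T (e j) = T.singularValues j • f j := by
  have hn : Module.finrank ℝ (EuclideanSpace ℝ (Fin n)) = n := by simp
  have hpos : ∀ j : Fin n, 0 < T.singularValues j := fun j =>
    T.injective_iff_forall_lt_finrank_singularValues_pos.1 hT j (by simp)
  obtain ⟨e, he⟩ : ∃ e : OrthonormalBasis (Fin n) ℝ (EuclideanSpace ℝ (Fin n)),
      ∀ j : Fin n, (adjoint T ∘ₗ T) (e j) = (T.singularValues j) ^ 2 • e j := by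
    refine ⟨T.isSymmetric_adjoint_comp_self.eigenvectorBasis hn, fun j => ?_⟩
    rw [T.sq_singularValues_fin hn]
    exact T.isSymmetric_adjoint_comp_self.apply_eigenvectorBasis hn j
  have horth : Orthonormal ℝ fun j : Fin n => (T.singularValues j)⁻¹ • T (e j) := by
    rw [orthonormal_iff_ite]
    intro i j
    have h1 : inner ℝ (T (e i)) (T (e j)) = T.singularValues j ^ 2 * inner ℝ (e i) (e j) := by
      rw [← LinearMap.adjoint_inner_right, ← LinearMap.comp_apply, he, inner_smul_right]
    rw [inner_smul_left, inner_smul_right, h1, orthonormal_iff_ite.1 e.orthonormal]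
    have := (hpos j).ne'
    split_ifs with h
    · subst h
      simp
      field_simp
    · simp
  obtain ⟨f, hf⟩ := Orthonormal.exists_orthonormalBasis_extension_of_card_eq (𝕜 := ℝ)
    (ι := Fin n) (by simp) (v := fun j : Fin n => (T.singularValues j)⁻¹ • T (e j)) (s := Set.univ)
    (horth.comp _ Subtype.val_injective)
  refine ⟨e, f, fun j => ?_⟩
  rw [hf j trivial, smul_smul, mul_inv_cancel₀ (hpos j).ne', one_smul]

theorem singularValues_pos_of_injective
    {T : EuclideanSpace ℝ (Fin n) →ₗ[ℝ] EuclideanSpace ℝ (Fin n)}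
    (hT : Function.Injective T) {j : ℕ} (hj : j < n) : 0 < T.singularValues j :=
  T.injective_iff_forall_lt_finrank_singularValues_pos.1 hT j (by simpa using hj)

/-- The product of the `m` largest singular values. -/
noncomputable def singularProd (m : ℕ)
    (T : EuclideanSpace ℝ (Fin n) →ₗ[ℝ] EuclideanSpace ℝ (Fin n)) : ℝ :=
  ∏ j ∈ Finset.range m, T.singularValues j

theorem singularProd_nonneg (m : ℕ)
    (T : EuclideanSpace ℝ (Fin n) →ₗ[ℝ] EuclideanSpace ℝ (Fin n)) : 0 ≤ singularProd m T :=
  Finset.prod_nonneg fun j _ => T.singularValues_nonneg j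

theorem singularProd_pos {m : ℕ} (hm : m ≤ n)
    {T : EuclideanSpace ℝ (Fin n) →ₗ[ℝ] EuclideanSpace ℝ (Fin n)}
    (hT : Function.Injective T) : 0 < singularProd m T :=
  Finset.prod_pos fun _ hj =>
    singularValues_pos_of_injective hT ((Finset.mem_range.1 hj).trans_le hm)

theorem singularProd_eq_abs_det (T : EuclideanSpace ℝ (Fin n) →ₗ[ℝ] EuclideanSpace ℝ (Fin n)) :
    singularProd n T = |LinearMap.det T| := by
  rw [← normDet_eq_abs_det, normDet_eq_prod_singularValues]
  simp [singularProd]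

/-- Expand every `T (v j)` in the basis `f`. Of the `n ^ m` index choices, those with a repetition
vanish because `ω` is alternating. The others carry a product of `m` distinct singular values, which
is at most the product of the `m` largest. -/
theorem abs_alternating_le {m : ℕ}
    {T : EuclideanSpace ℝ (Fin n) →ₗ[ℝ] EuclideanSpace ℝ (Fin n)}
    {e f : OrthonormalBasis (Fin n) ℝ (EuclideanSpace ℝ (Fin n))}
    (hef : ∀ j : Fin n, T (e j) = T.singularValues j • f j)
    (ω : EuclideanSpace ℝ (Fin n) [⋀^Fin m]→ₗ[ℝ] ℝ) {M : ℝ}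
    (hM : ∀ g : Fin m → Fin n, |ω (fun j => f (g j))| ≤ M)
    {v : Fin m → EuclideanSpace ℝ (Fin n)} (hv : ∀ j, ‖v j‖ ≤ 1) :
    |ω (fun j => T (v j))| ≤ (n : ℝ) ^ m * (singularProd m T * M) := by
  have hexp : (fun j => T (v j)) =
      fun j => ∑ i, (inner ℝ (e i) (v j) * T.singularValues i) • f i := by
    funext j
    conv_lhs => rw [← e.sum_repr' (v j), map_sum]
    simp [hef, mul_smul]
  rw [hexp, ← AlternatingMap.coe_multilinearMap, MultilinearMap.map_sum]
  have hterm : ∀ g : Fin m → Fin n,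
      |ω.toMultilinearMap
        (fun j => (inner ℝ (e (g j)) (v j) * T.singularValues (g j)) • f (g j))| ≤
        singularProd m T * M := by
    intro g
    rw [MultilinearMap.map_smul_univ, smul_eq_mul, abs_mul, Finset.prod_mul_distrib, abs_mul]
    have hM0 : 0 ≤ M := (abs_nonneg _).trans (hM g)
    by_cases hg : Function.Injective g
    · have h1 : |∏ j, inner ℝ (e (g j)) (v j)| ≤ 1 := by
        rw [Finset.abs_prod]
        refine Finset.prod_le_one (fun _ _ => abs_nonneg _) fun j _ => ?_
        refine (abs_real_inner_le_norm _ _).trans ?_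
        simpa using hv j
      have h2 : |∏ j, T.singularValues (g j)| ≤ singularProd m T := by
        rw [abs_of_nonneg (Finset.prod_nonneg fun j _ => T.singularValues_nonneg _)]
        have hinj : Function.Injective fun j : Fin m => ((g j : Fin n) : ℕ) :=
          Fin.val_injective.comp hg
        have := Finset.prod_le_prod_range_card_of_antitone T.singularValues_antitone
          T.singularValues_nonneg (Finset.univ.map ⟨_, hinj⟩)
        simpa [singularProd] using this
      calc _ ≤ 1 * singularProd m T * M := by
            refine mul_le_mul (mul_le_mul h1 h2 (abs_nonneg _) zero_le_one) (hM g)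
              (abs_nonneg _) (by simpa using singularProd_nonneg m T)
        _ = _ := by rw [one_mul]
    · have : ω.toMultilinearMap (fun j => f (g j)) = 0 := by
        rw [AlternatingMap.coe_multilinearMap]
        exact ω.map_eq_zero_of_not_injective _ fun h => hg fun a b hab => h (by simp [hab])
      rw [this]
      simpa using mul_nonneg (singularProd_nonneg m T) hM0
  refine (Finset.abs_sum_le_sum_abs _ _).trans ((Finset.sum_le_sum fun g _ => hterm g).trans ?_)
  simp

/-- The product of the `m` largest singular values is the operator norm on the `m`-th exterior
power, hence submultiplicative. A crude constant depending only on `n` is enough, and it spares the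
exterior power: a single determinant form is tested instead. -/
theorem exists_singularProd_comp_le (n : ℕ) : ∃ K : ℝ, 1 ≤ K ∧
    ∀ m ≤ n, ∀ A B : EuclideanSpace ℝ (Fin n) →ₗ[ℝ] EuclideanSpace ℝ (Fin n),
      Function.Injective A → Function.Injective B →
      singularProd m (A ∘ₗ B) ≤ K * (singularProd m A * singularProd m B) := by
  rcases Nat.eq_zero_or_pos n with rfl | hn
  · refine ⟨1, le_rfl, fun m hm A B _ _ => ?_⟩
    obtain rfl : m = 0 := by omega
    simp [singularProd]
  have hn1 : (1 : ℝ) ≤ n := by exact_mod_cast hn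
  refine ⟨(n : ℝ) ^ n * (n : ℝ) ^ n * n.factorial, ?_, fun m hm A B hA hB => ?_⟩
  · have h1 : (1 : ℝ) ≤ (n : ℝ) ^ n := one_le_pow₀ hn1
    have h2 : (1 : ℝ) ≤ n.factorial := by exact_mod_cast Nat.factorial_pos n
    calc (1 : ℝ) = 1 * 1 * 1 := by norm_num
      _ ≤ _ := by gcongr
  obtain ⟨e, f, hef⟩ := exists_singular_bases (T := A ∘ₗ B) (hA.comp hB)
  obtain ⟨p, q, hpq⟩ := exists_singular_bases hB
  obtain ⟨r, s, hrs⟩ := exists_singular_bases hA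
  -- `ω` is the determinant of the coordinates along the first `m` left singular vectors of `A ∘ B`;
  -- on the images of the right singular vectors the matrix is diagonal.
  let L : EuclideanSpace ℝ (Fin n) →ₗ[ℝ] (Fin m → ℝ) :=
    LinearMap.pi fun i => (innerSL ℝ (f (Fin.castLE hm i))).toLinearMap
  let ω : EuclideanSpace ℝ (Fin n) [⋀^Fin m]→ₗ[ℝ] ℝ :=
    Matrix.detRowAlternating.compLinearMap L
  have hω : ∀ v, ω v = Matrix.det (Matrix.of fun i j => inner ℝ (f (Fin.castLE hm j)) (v i)) :=
    fun v => rfl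
  have h1 : ω (fun j => (A ∘ₗ B) (e (Fin.castLE hm j))) = singularProd m (A ∘ₗ B) := by
    rw [hω]
    have : (Matrix.of fun i j : Fin m => inner ℝ (f (Fin.castLE hm j))
        ((A ∘ₗ B) (e (Fin.castLE hm i)))) =
        Matrix.diagonal fun i : Fin m => (A ∘ₗ B).singularValues i := by
      ext i j
      rw [Matrix.of_apply, hef, inner_smul_right, orthonormal_iff_ite.1 f.orthonormal,
        Matrix.diagonal_apply]
      by_cases h : i = j
      · simp [h]
      · simp [h, Ne.symm h]
    rw [this, Matrix.det_diagonal, singularProd, Finset.prod_range]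
  have h2 : ∀ g : Fin m → Fin n, |ω fun j => s (g j)| ≤ m.factorial := by
    intro g
    rw [hω]
    have := Matrix.det_le (A := Matrix.of fun i j : Fin m => inner ℝ (f (Fin.castLE hm j)) (s (g i)))
      (abv := AbsoluteValue.abs) (x := (1 : ℝ)) fun i j => by
        refine (abs_real_inner_le_norm (f (Fin.castLE hm j)) (s (g i))).trans ?_
        simp
    simpa using this
  -- The expansion bound is used twice: for `A` on the left singular vectors of `B`, then for `B`
  -- with the pulled-back form.
  have h3 : ∀ g : Fin m → Fin n, |ω fun j => A (q (g j))| ≤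
      (n : ℝ) ^ m * (singularProd m A * m.factorial) := fun g =>
    abs_alternating_le hrs ω h2 fun j => by simp
  have h4 := abs_alternating_le hpq (ω.compLinearMap A) h3 (v := fun j => e (Fin.castLE hm j))
    fun j => by simp
  have h5 : singularProd m (A ∘ₗ B) ≤
      (n : ℝ) ^ m * (singularProd m B * ((n : ℝ) ^ m * (singularProd m A * m.factorial))) := by
    rw [← h1]
    exact (le_abs_self _).trans h4
  have h6 := mul_nonneg (singularProd_nonneg m A) (singularProd_nonneg m B)
  calc _ ≤ _ := h5
    _ = (n : ℝ) ^ m * (n : ℝ) ^ m * m.factorial * (singularProd m A * singularProd m B) := by ring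
    _ ≤ _ := by
      have : (m.factorial : ℝ) ≤ n.factorial := by exact_mod_cast Nat.factorial_le hm
      gcongr

end LinearMap

namespace LinearMap

variable {n : ℕ}

theorem singularValues_le_of_norm_le
    {T : EuclideanSpace ℝ (Fin n) →ₗ[ℝ] EuclideanSpace ℝ (Fin n)} (hT : Function.Injective T)
    {c : ℝ} (hc : 0 ≤ c) (h : ∀ x, ‖T x‖ ≤ c * ‖x‖) (j : ℕ) : T.singularValues j ≤ c := by
  rcases lt_or_ge j n with hj | hj
  · obtain ⟨e, f, hef⟩ := exists_singular_bases hT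
    have := h (e ⟨j, hj⟩)
    rw [hef, norm_smul] at this
    simpa [abs_of_nonneg (T.singularValues_nonneg j)] using this
  · rwa [T.singularValues_of_finrank_le (by simpa using hj)]

end LinearMap

/-! ### The singular value function -/

theorem sum_range_clamp (n : ℕ) {t : ℝ} (ht : 0 ≤ t) :
    ∑ j ∈ Finset.range n, min (max (t - j) 0) 1 = min t n := by
  induction n with
  | zero => simp [ht]
  | succ n ih =>
    rw [Finset.sum_range_succ, ih]
    push_cast
    rcases le_total t n with h | h
    · rw [min_eq_left h, max_eq_right (by linarith), min_eq_left zero_le_one,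
        min_eq_left (by linarith), add_zero]
    · rw [min_eq_right h, max_eq_left (by linarith)]
      rcases le_total t (n + 1) with h' | h'
      · rw [min_eq_left (by linarith), min_eq_left h']
        ring
      · rw [min_eq_right (by linarith), min_eq_right h']

section singularValueFunction

variable {n : ℕ} {T : EuclideanSpace ℝ (Fin n) →ₗ[ℝ] EuclideanSpace ℝ (Fin n)}

open LinearMap

theorem singularProd_succ (m : ℕ) : singularProd (m + 1) T = singularProd m T * T.singularValues m :=
  Finset.prod_range_succ _ _

theorem singularValueFunction_of_le {t : ℝ} (htn : t ≤ n) :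
    singularValueFunction t T = singularProd (⌈t⌉₊ - 1) T *
      T.singularValues (⌈t⌉₊ - 1) ^ (t - ((⌈t⌉₊ - 1 : ℕ) : ℝ)) :=
  if_pos htn

theorem singularValueFunction_of_lt {t : ℝ} (htn : n < t) :
    singularValueFunction t T = singularProd n T ^ (t / n) := by
  rw [singularProd_eq_abs_det]
  exact if_neg htn.not_ge

theorem singularValueFunction_zero : singularValueFunction 0 T = 1 := by
  rw [singularValueFunction_of_le (by positivity)]
  simp [singularProd]

variable [NeZero n]

theorem ceil_sub_one_spec {t : ℝ} (h0 : 0 ≤ t) (htn : t ≤ n) :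
    ⌈t⌉₊ - 1 < n ∧ ((⌈t⌉₊ - 1 : ℕ) : ℝ) ≤ t ∧ t ≤ ((⌈t⌉₊ - 1 : ℕ) : ℝ) + 1 := by
  have hn := NeZero.pos n
  rcases h0.eq_or_lt with rfl | ht
  · simp [hn]
  have hc : 0 < ⌈t⌉₊ := Nat.ceil_pos.2 ht
  have hcn : ⌈t⌉₊ ≤ n := Nat.ceil_le.2 htn
  have h1 : ((⌈t⌉₊ - 1 : ℕ) : ℝ) + 1 = ⌈t⌉₊ := by
    exact_mod_cast Nat.sub_add_cancel hc
  refine ⟨by omega, ?_, ?_⟩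
  · have := Nat.ceil_lt_add_one h0
    linarith
  · rw [h1]
    exact Nat.le_ceil t

theorem singularValueFunction_pos (hT : Function.Injective T) {t : ℝ} (ht : 0 ≤ t) :
    0 < singularValueFunction t T := by
  rcases le_or_gt t n with h | h
  · obtain ⟨h1, -, -⟩ := ceil_sub_one_spec ht h
    rw [singularValueFunction_of_le h]
    exact mul_pos (singularProd_pos h1.le hT)
      (Real.rpow_pos_of_pos (singularValues_pos_of_injective hT h1) _)
  · rw [singularValueFunction_of_lt h]
    exact Real.rpow_pos_of_pos (singularProd_pos le_rfl hT) _

/-- One formula for all `t ≥ 0`, with exponents continuous and monotone in `t`: continuity and decay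
in `t` need no gluing at integers or at `t = n`. -/
theorem singularValueFunction_eq_prod (hT : Function.Injective T) {t : ℝ} (ht : 0 ≤ t) :
    singularValueFunction t T =
      (∏ j ∈ Finset.range n, T.singularValues j ^ min (max (t - j) 0) 1) *
        singularProd n T ^ max (t / n - 1) 0 := by
  have hn : (0 : ℝ) < n := by exact_mod_cast NeZero.pos n
  rcases le_or_gt t n with h | h
  · rw [singularValueFunction_of_le h]
    obtain ⟨h1, h2, h3⟩ := ceil_sub_one_spec ht h
    generalize ⌈t⌉₊ - 1 = m at *
    have h4 : t / n - 1 ≤ 0 := by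
      rw [sub_nonpos, div_le_one hn]
      exact h
    rw [max_eq_right h4, Real.rpow_zero, mul_one]
    have hsub : Finset.range (m + 1) ⊆ Finset.range n := Finset.range_subset_range.2 h1
    rw [← Finset.prod_subset hsub, Finset.prod_range_succ, max_eq_left (by linarith),
      min_eq_left (by linarith), singularProd]
    · congr 1
      refine Finset.prod_congr rfl fun j hj => ?_
      have : (j : ℝ) + 1 ≤ m := by exact_mod_cast Finset.mem_range.1 hj
      rw [max_eq_left (by linarith), min_eq_right (by linarith), Real.rpow_one]
    · intro j _ hj
      have : (m : ℝ) + 1 ≤ j := by exact_mod_cast not_lt.1 (fun h => hj (Finset.mem_range.2 h))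
      rw [max_eq_right (by linarith), min_eq_left zero_le_one, Real.rpow_zero]
  · rw [singularValueFunction_of_lt h]
    have h4 : 0 ≤ t / n - 1 := by
      rw [sub_nonneg, one_le_div hn]
      exact h.le
    have h5 : ∏ j ∈ Finset.range n, T.singularValues j ^ min (max (t - j) 0) 1 =
        singularProd n T := by
      refine Finset.prod_congr rfl fun j hj => ?_
      have : (j : ℝ) + 1 ≤ n := by exact_mod_cast Finset.mem_range.1 hj
      rw [max_eq_left (by linarith), min_eq_right (by linarith), Real.rpow_one]
    rw [h5, max_eq_left h4, Real.rpow_sub_one (singularProd_pos le_rfl hT).ne',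
      mul_div_cancel₀ _ (singularProd_pos le_rfl hT).ne']

theorem continuousOn_singularValueFunction (hT : Function.Injective T) :
    ContinuousOn (fun t => singularValueFunction t T) (Set.Ici 0) := by
  refine ContinuousOn.congr (Continuous.continuousOn ?_)
    fun t ht => singularValueFunction_eq_prod hT ht
  refine (continuous_finsetProd _ fun j hj => ?_).mul ?_
  · refine Continuous.rpow continuous_const (by fun_prop) fun t => Or.inl ?_
    exact (singularValues_pos_of_injective hT (Finset.mem_range.1 hj)).ne'
  · exact Continuous.rpow continuous_const (by fun_prop) fun t =>
      Or.inl (singularProd_pos le_rfl hT).ne'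

/-- Each factor of the clamped formula gains `c` to the increase of its exponent (`c ^ n` for the
determinant factor), and these increases add up to `u - t`. -/
theorem singularValueFunction_le_rpow_mul (hT : Function.Injective T) {c : ℝ} (hc : 0 < c)
    (hTc : ∀ j, T.singularValues j ≤ c) {t u : ℝ} (ht : 0 ≤ t) (htu : t ≤ u) :
    singularValueFunction u T ≤ c ^ (u - t) * singularValueFunction t T := by
  have hn : (0 : ℝ) < n := by exact_mod_cast NeZero.pos n
  have hu := ht.trans htu
  have key : ∀ {x d y z : ℝ}, 0 < x → x ≤ d → y ≤ z → x ^ z ≤ d ^ (z - y) * x ^ y := by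
    intro x d y z hx hxd hyz
    calc x ^ z = x ^ (z - y) * x ^ y := by rw [← Real.rpow_add hx]; ring_nf
      _ ≤ _ := by
        have := Real.rpow_le_rpow hx.le hxd (sub_nonneg.2 hyz)
        have := (Real.rpow_pos_of_pos hx y).le
        gcongr
  have hP : singularProd n T ≤ c ^ (n : ℝ) := by
    rw [Real.rpow_natCast]
    calc _ ≤ ∏ _j ∈ Finset.range n, c :=
          Finset.prod_le_prod (fun j _ => T.singularValues_nonneg j) fun j _ => hTc j
      _ = _ := by simp
  rw [singularValueFunction_eq_prod hT ht, singularValueFunction_eq_prod hT hu]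
  have h1 : ∏ j ∈ Finset.range n, T.singularValues j ^ min (max (u - j) 0) 1 ≤
      c ^ (min u n - min t n) *
        ∏ j ∈ Finset.range n, T.singularValues j ^ min (max (t - j) 0) 1 := by
    rw [← sum_range_clamp n ht, ← sum_range_clamp n hu, ← Finset.sum_sub_distrib,
      Real.rpow_sum_of_pos hc, ← Finset.prod_mul_distrib]
    refine Finset.prod_le_prod (fun j _ => Real.rpow_nonneg (T.singularValues_nonneg j) _)
      fun j hj => ?_
    exact key (singularValues_pos_of_injective hT (Finset.mem_range.1 hj)) (hTc j)
      (by gcongr)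
  have h2 := key (singularProd_pos le_rfl hT) hP
    (show max (t / n - 1) 0 ≤ max (u / n - 1) 0 by gcongr)
  have h3 : ∀ r : ℝ, n * max (r / n - 1) 0 = r - min r n := by
    intro r
    rw [mul_max_of_nonneg _ _ hn.le, mul_sub, mul_div_cancel₀ _ hn.ne', mul_one, mul_zero]
    rcases le_total r n with h | h
    · rw [max_eq_right (by linarith), min_eq_left h, sub_self]
    · rw [max_eq_left (by linarith), min_eq_right h]
  have h4 : c ^ (min u n - min t n) *
      (c ^ (n : ℝ)) ^ (max (u / n - 1) 0 - max (t / n - 1) 0) = c ^ (u - t) := by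
    rw [← Real.rpow_mul hc.le, ← Real.rpow_add hc]
    congr 1
    rw [mul_sub, h3, h3]
    ring
  have hpos : ∀ r : ℝ,
      0 ≤ ∏ j ∈ Finset.range n, T.singularValues j ^ min (max (r - j) 0) 1 := fun r =>
    Finset.prod_nonneg fun j _ => Real.rpow_nonneg (T.singularValues_nonneg j) _
  refine (mul_le_mul h1 h2 (Real.rpow_nonneg (singularProd_nonneg n T) _) ?_).trans_eq ?_
  · exact mul_nonneg (Real.rpow_nonneg hc.le _) (hpos t)
  · rw [← h4]
    ring

/-- For `t ≤ n`, `φ^t` is the geometric mean of two consecutive singular products with weights `1 -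
(t - m)` and `t - m`. The weights sum to `1`, so `K` appears to the first power. For `t > n` the
determinant is multiplicative. -/
theorem singularValueFunction_comp_le {A B : EuclideanSpace ℝ (Fin n) →ₗ[ℝ] EuclideanSpace ℝ (Fin n)}
    (hA : Function.Injective A) (hB : Function.Injective B) {K : ℝ} (hK : 1 ≤ K)
    (hAB : ∀ m ≤ n, singularProd m (A ∘ₗ B) ≤ K * (singularProd m A * singularProd m B))
    {t : ℝ} (ht : 0 ≤ t) :
    singularValueFunction t (A ∘ₗ B) ≤
      K * (singularValueFunction t A * singularValueFunction t B) := by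
  rcases le_or_gt t n with h | h
  · obtain ⟨h1, h2, h3⟩ := ceil_sub_one_spec ht h
    simp only [singularValueFunction_of_le h]
    generalize ⌈t⌉₊ - 1 = m at *
    have hform : ∀ {T : EuclideanSpace ℝ (Fin n) →ₗ[ℝ] EuclideanSpace ℝ (Fin n)},
        Function.Injective T → singularProd m T * T.singularValues m ^ (t - m) =
          singularProd m T ^ (1 - (t - m)) * singularProd (m + 1) T ^ (t - m) := by
      intro T hT
      have hp := singularProd_pos h1.le hT
      rw [singularProd_succ, Real.mul_rpow hp.le (T.singularValues_nonneg m), ← mul_assoc,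
        ← Real.rpow_add hp]
      simp
    rw [hform (T := A ∘ₗ B) (hA.comp hB), hform hA, hform hB]
    have h4 : ∀ k, ∀ {θ : ℝ}, k ≤ n → 0 ≤ θ → singularProd k (A ∘ₗ B) ^ θ ≤
        K ^ θ * (singularProd k A ^ θ * singularProd k B ^ θ) := by
      intro k θ hk hθ
      rw [← Real.mul_rpow (singularProd_nonneg _ _) (singularProd_nonneg _ _),
        ← Real.mul_rpow (by linarith)
          (mul_nonneg (singularProd_nonneg _ _) (singularProd_nonneg _ _))]
      exact Real.rpow_le_rpow (singularProd_nonneg _ _) (hAB k hk) hθ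
    have hnn : ∀ (k : ℕ) (T : EuclideanSpace ℝ (Fin n) →ₗ[ℝ] EuclideanSpace ℝ (Fin n)) (θ : ℝ),
        0 ≤ singularProd k T ^ θ := fun k T θ => Real.rpow_nonneg (singularProd_nonneg k T) _
    have hKθ : ∀ θ : ℝ, 0 ≤ K ^ θ := fun θ => Real.rpow_nonneg (by linarith) _
    refine (mul_le_mul (h4 m h1.le (θ := 1 - (t - m)) (by linarith))
      (h4 (m + 1) h1 (θ := t - m) (by linarith)) (hnn _ _ _)
      (mul_nonneg (hKθ _) (mul_nonneg (hnn _ _ _) (hnn _ _ _)))).trans_eq ?_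
    have : K = K ^ (1 - (t - m)) * K ^ (t - m) := by
      rw [← Real.rpow_add (by linarith)]
      simp
    conv_rhs => rw [this]
    ring
  · rw [singularValueFunction_of_lt h, singularValueFunction_of_lt h, singularValueFunction_of_lt h]
    simp only [singularProd_eq_abs_det, LinearMap.det_comp, abs_mul]
    rw [Real.mul_rpow (abs_nonneg _) (abs_nonneg _)]
    exact le_mul_of_one_le_left (mul_nonneg (Real.rpow_nonneg (abs_nonneg _) _)
      (Real.rpow_nonneg (abs_nonneg _) _)) hK

/-- The covering count always produces the product on the left, even for `t > n`. There `m = n - 1`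
works, because the smallest singular value to the power `n` is at most the determinant. -/
theorem exists_singularProd_mul_rpow_le (n : ℕ) [NeZero n] {t : ℝ} (ht : 0 ≤ t) :
    ∃ m < n, (m : ℝ) ≤ t ∧ ∀ T : EuclideanSpace ℝ (Fin n) →ₗ[ℝ] EuclideanSpace ℝ (Fin n),
      Function.Injective T →
        singularProd m T * T.singularValues m ^ (t - m) ≤ singularValueFunction t T := by
  rcases le_or_gt t n with h | h
  · obtain ⟨h1, h2, -⟩ := ceil_sub_one_spec ht h
    exact ⟨_, h1, h2, fun T _ => (singularValueFunction_of_le h).ge⟩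
  have hn : (0 : ℝ) < n := by exact_mod_cast NeZero.pos n
  obtain ⟨k, hk⟩ : ∃ k, n = k + 1 := ⟨n - 1, (Nat.sub_add_cancel (NeZero.pos n)).symm⟩
  have hkn : k < n := by omega
  have hk' : (n : ℝ) = k + 1 := by exact_mod_cast hk
  refine ⟨k, hkn, by linarith, fun T hT => ?_⟩
  have hα := singularValues_pos_of_injective hT hkn
  have hP := singularProd_pos le_rfl hT
  have h1 : singularProd k T * T.singularValues k = singularProd n T := by
    rw [← singularProd_succ, ← hk]
  have h2 : T.singularValues k ^ (n : ℝ) ≤ singularProd n T := by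
    rw [Real.rpow_natCast]
    calc _ = ∏ _j ∈ Finset.range n, T.singularValues k := by simp
      _ ≤ _ := Finset.prod_le_prod (fun _ _ => hα.le) fun j hj =>
        T.singularValues_antitone (by have := Finset.mem_range.1 hj; omega)
  have h3 : 0 ≤ t / n - 1 := by
    rw [sub_nonneg, one_le_div hn]
    exact h.le
  rw [singularValueFunction_of_lt h]
  calc singularProd k T * T.singularValues k ^ (t - k)
      = singularProd n T * (T.singularValues k ^ (n : ℝ)) ^ (t / n - 1) := by
        rw [← h1, mul_assoc, ← Real.rpow_mul hα.le, mul_sub, mul_div_cancel₀ _ hn.ne', mul_one,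
          hk', mul_comm (T.singularValues k), ← Real.rpow_add_one hα.ne']
        ring_nf
    _ ≤ singularProd n T * singularProd n T ^ (t / n - 1) := by
        have := Real.rpow_le_rpow (Real.rpow_nonneg hα.le _) h2 h3
        gcongr
    _ = singularProd n T ^ (t / n) := by
        rw [mul_comm, ← Real.rpow_add_one hP.ne']
        ring_nf

end singularValueFunction

/-! ### Word sums and the affinity dimension -/

namespace AffineIFS

variable {n N : ℕ} (S : AffineIFS n N)

/-- The linear part of the composition along a word. -/
noncomputable def wordLinear {k : ℕ} (w : Fin k → Fin N) :
    EuclideanSpace ℝ (Fin n) →ₗ[ℝ] EuclideanSpace ℝ (Fin n) :=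
  (S.wordMap w).linear.toLinearMap

theorem wordLinear_injective {k : ℕ} (w : Fin k → Fin N) : Function.Injective (S.wordLinear w) :=
  (S.wordMap w).linear.injective

theorem wordMap_append {j k : ℕ} (v : Fin j → Fin N) (w : Fin k → Fin N) :
    S.wordMap (Fin.append v w) = S.wordMap v * S.wordMap w := by
  simp only [wordMap]
  rw [← List.prod_append, ← List.ofFn_fin_append]
  congr 2
  funext i
  exact Fin.addCases (fun i => by simp) (fun i => by simp) i

theorem wordLinear_append {j k : ℕ} (v : Fin j → Fin N) (w : Fin k → Fin N) :
    S.wordLinear (Fin.append v w) = S.wordLinear v ∘ₗ S.wordLinear w := by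
  rw [wordLinear, wordMap_append]
  rfl

theorem wordMap_zero (w : Fin 0 → Fin N) : S.wordMap w = 1 := by
  simp [wordMap]

theorem wordMap_one (w : Fin 1 → Fin N) : S.wordMap w = S.map (w 0) := by
  simp [wordMap]

theorem wordMap_succ {k : ℕ} (w : Fin (k + 1) → Fin N) :
    S.wordMap w = S.map (w 0) * S.wordMap (Fin.tail w) := by
  simp [wordMap, List.ofFn_succ, Fin.tail]

theorem wordMap_sub {k : ℕ} (w : Fin k → Fin N) (x y : EuclideanSpace ℝ (Fin n)) :
    S.wordMap w x - S.wordMap w y = S.wordLinear w (x - y) :=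
  ((S.wordMap w).toAffineMap.linearMap_vsub x y).symm

theorem exists_contraction_ratio [NeZero N] : ∃ c : ℝ, 0 < c ∧ c < 1 ∧
    ∀ (k : ℕ) (w : Fin k → Fin N) (x y : EuclideanSpace ℝ (Fin n)),
      dist (S.wordMap w x) (S.wordMap w y) ≤ c ^ k * dist x y := by
  choose c hc0 hc1 hc using S.contracting
  obtain ⟨i₀, hi₀⟩ := Finite.exists_max c
  refine ⟨c i₀, hc0 i₀, hc1 i₀, fun k => ?_⟩
  induction k with
  | zero => intro w x y; simp [wordMap_zero]
  | succ k ih =>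
    intro w x y
    rw [wordMap_succ]
    calc _ ≤ c (w 0) * dist (S.wordMap (Fin.tail w) x) (S.wordMap (Fin.tail w) y) := hc _ _ _
      _ ≤ c i₀ * (c i₀ ^ k * dist x y) :=
        mul_le_mul (hi₀ _) (ih _ _ _) dist_nonneg (hc0 i₀).le
      _ = _ := by ring

theorem singularValues_wordLinear_le {c : ℝ} (hc0 : 0 < c)
    (hc : ∀ (k : ℕ) (w : Fin k → Fin N) (x y : EuclideanSpace ℝ (Fin n)),
      dist (S.wordMap w x) (S.wordMap w y) ≤ c ^ k * dist x y)
    {k : ℕ} (w : Fin k → Fin N) (j : ℕ) : (S.wordLinear w).singularValues j ≤ c ^ k := by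
  refine LinearMap.singularValues_le_of_norm_le (S.wordLinear_injective w) (by positivity)
    (fun x => ?_) j
  have := hc k w x 0
  rwa [dist_eq_norm, wordMap_sub, dist_zero_right, sub_zero] at this

theorem wordSum_eq (k : ℕ) (t : ℝ) :
    S.wordSum k t = ∑ w : Fin k → Fin N, singularValueFunction t (S.wordLinear w) :=
  rfl

theorem wordSum_zero_right (k : ℕ) : S.wordSum k 0 = (N : ℝ) ^ k := by
  simp [wordSum_eq, singularValueFunction_zero]

variable [NeZero n]

theorem continuousOn_wordSum (k : ℕ) : ContinuousOn (S.wordSum k) (Set.Ici 0) :=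
  continuousOn_finsetSum _ fun w _ => continuousOn_singularValueFunction (S.wordLinear_injective w)

theorem exists_wordSum_add_le : ∃ K : ℝ, 1 ≤ K ∧ ∀ (t : ℝ), 0 ≤ t → ∀ j k : ℕ,
    S.wordSum (j + k) t ≤ K * (S.wordSum j t * S.wordSum k t) := by
  obtain ⟨K, hK, h⟩ := LinearMap.exists_singularProd_comp_le n
  refine ⟨K, hK, fun t ht j k => ?_⟩
  simp only [wordSum_eq]
  rw [← (Fin.appendEquiv j k).sum_comp, Fintype.sum_mul_sum, Finset.mul_sum, Fintype.sum_prod_type]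
  refine Finset.sum_le_sum fun v _ => ?_
  rw [Finset.mul_sum]
  refine Finset.sum_le_sum fun w _ => ?_
  change singularValueFunction t (S.wordLinear (Fin.append v w)) ≤ _
  rw [wordLinear_append]
  exact singularValueFunction_comp_le (S.wordLinear_injective v) (S.wordLinear_injective w) hK
    (fun m hm => h m hm _ _ (S.wordLinear_injective v) (S.wordLinear_injective w)) ht

theorem wordSum_le_rpow_mul {c : ℝ} (hc0 : 0 < c)
    (hc : ∀ (k : ℕ) (w : Fin k → Fin N) (x y : EuclideanSpace ℝ (Fin n)),
      dist (S.wordMap w x) (S.wordMap w y) ≤ c ^ k * dist x y)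
    (k : ℕ) {t u : ℝ} (ht : 0 ≤ t) (htu : t ≤ u) :
    S.wordSum k u ≤ (c ^ k) ^ (u - t) * S.wordSum k t := by
  rw [wordSum_eq, wordSum_eq, Finset.mul_sum]
  exact Finset.sum_le_sum fun w _ => singularValueFunction_le_rpow_mul (S.wordLinear_injective w)
    (by positivity) (S.singularValues_wordLinear_le hc0 hc w) ht htu

variable [NeZero N]

theorem wordSum_pos (k : ℕ) {t : ℝ} (ht : 0 ≤ t) : 0 < S.wordSum k t :=
  Finset.sum_pos (fun w _ => singularValueFunction_pos (S.wordLinear_injective w) ht)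
    Finset.univ_nonempty

theorem wordSum_lt_of_lt {k : ℕ} (hk : k ≠ 0) {t u : ℝ} (ht : 0 ≤ t) (htu : t < u) :
    S.wordSum k u < S.wordSum k t := by
  obtain ⟨c, hc0, hc1, hc⟩ := S.exists_contraction_ratio
  refine (S.wordSum_le_rpow_mul hc0 hc k ht htu.le).trans_lt ?_
  exact mul_lt_of_lt_one_left (S.wordSum_pos k ht)
    (Real.rpow_lt_one (by positivity) (pow_lt_one₀ hc0.le hc1 hk) (sub_pos.2 htu))

theorem exists_wordSum_lt_one : ∃ u : ℝ, 0 ≤ u ∧ ∀ k ≠ 0, S.wordSum k u < 1 := by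
  obtain ⟨c, hc0, hc1, hc⟩ := S.exists_contraction_ratio
  have hN : (0 : ℝ) < N := by exact_mod_cast NeZero.pos N
  -- With `N * c ^ m < 1`, the exponent `m` works for all lengths at once, since the sum at `0` is
  -- `N ^ k`.
  obtain ⟨m, hm⟩ := exists_pow_lt_of_lt_one (inv_pos.2 hN) hc1
  refine ⟨m, by positivity, fun k hk => ?_⟩
  have h := S.wordSum_le_rpow_mul hc0 hc k le_rfl (Nat.cast_nonneg m)
  rw [sub_zero, Real.rpow_natCast, wordSum_zero_right, ← pow_mul, mul_comm k m, pow_mul,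
    ← mul_pow] at h
  refine h.trans_lt (pow_lt_one₀ (by positivity) ?_ hk)
  rwa [← lt_div_iff₀ hN, one_div]

theorem existsUnique_wordSum_eq_one {k : ℕ} (hk : 1 ≤ k) :
    ∃! t : ℝ, 0 ≤ t ∧ S.wordSum k t = 1 := by
  have hk0 : k ≠ 0 := by omega
  obtain ⟨u, hu0, hu⟩ := S.exists_wordSum_lt_one
  have hN : (1 : ℝ) ≤ N := by exact_mod_cast NeZero.pos N
  have h0 : 1 ≤ S.wordSum k 0 := by
    rw [wordSum_zero_right]
    exact one_le_pow₀ hN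
  obtain ⟨t, ht, htk⟩ := intermediate_value_Icc' hu0
    ((S.continuousOn_wordSum k).mono Set.Icc_subset_Ici_self) ⟨(hu k hk0).le, h0⟩
  refine ⟨t, ⟨ht.1, htk⟩, fun v hv => ?_⟩
  rcases lt_trichotomy v t with h | h | h
  · exact absurd (S.wordSum_lt_of_lt hk0 hv.1 h) (by rw [htk, hv.2]; exact lt_irrefl _)
  · exact h
  · exact absurd (S.wordSum_lt_of_lt hk0 ht.1 h) (by rw [htk, hv.2]; exact lt_irrefl _)

theorem levelDimension_spec {k : ℕ} (hk : k ≠ 0) :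
    0 ≤ S.levelDimension k ∧ S.wordSum k (S.levelDimension k) = 1 :=
  Classical.epsilon_spec (S.existsUnique_wordSum_eq_one (Nat.one_le_iff_ne_zero.2 hk)).exists

theorem levelDimension_lt_iff {k : ℕ} (hk : k ≠ 0) {t : ℝ} (ht : 0 ≤ t) :
    S.levelDimension k < t ↔ S.wordSum k t < 1 := by
  obtain ⟨h0, h1⟩ := S.levelDimension_spec hk
  constructor
  · intro h
    rw [← h1]
    exact S.wordSum_lt_of_lt hk h0 h
  · intro h
    by_contra! hle
    rcases hle.eq_or_lt with rfl | hlt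
    · exact h.ne h1
    · exact absurd (S.wordSum_lt_of_lt hk ht hlt) (by rw [h1]; exact h.le.not_gt)

/-- If infinitely many level dimensions are below `t`, then all late ones are below any `u > t`. -/
theorem eventually_levelDimension_lt {t u : ℝ} (htu : t < u)
    (h : ∃ᶠ k in atTop, S.levelDimension k < t) : ∀ᶠ k in atTop, S.levelDimension k < u := by
  obtain ⟨c, hc0, hc1, hc⟩ := S.exists_contraction_ratio
  obtain ⟨K, hK, hsub⟩ := S.exists_wordSum_add_le
  have ht : 0 ≤ t := by
    obtain ⟨k, hk, hk0⟩ := (h.and_eventually (eventually_ne_atTop 0)).exists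
    exact (S.levelDimension_spec hk0).1.trans hk.le
  have hu : 0 ≤ u := ht.trans htu.le
  have hlim : Tendsto (fun k : ℕ => K * (c ^ k) ^ (u - t)) atTop (𝓝 0) := by
    have h1 := (tendsto_pow_atTop_nhds_zero_of_lt_one hc0.le hc1).rpow_const
      (p := u - t) (Or.inr (sub_pos.2 htu).le)
    rw [Real.zero_rpow (sub_pos.2 htu).ne'] at h1
    simpa using h1.const_mul K
  -- A length at which the decay gained from `t` to `u` already beats the constant `K`.
  obtain ⟨k, ⟨hkt, hk⟩, hk0⟩ := ((h.and_eventually (hlim.eventually_lt_const one_pos)).and_eventually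
    (eventually_ne_atTop 0)).exists
  have hKW : K * S.wordSum k u < 1 := by
    have h1 := (S.levelDimension_lt_iff hk0 ht).1 hkt
    have h2 := S.wordSum_le_rpow_mul hc0 hc k ht htu.le
    have h3 : 0 < (c ^ k) ^ (u - t) := by positivity
    calc _ ≤ K * ((c ^ k) ^ (u - t) * S.wordSum k t) := by gcongr
      _ ≤ K * ((c ^ k) ^ (u - t) * 1) := by gcongr
      _ < 1 := by rwa [mul_one]
  have hpos : ∀ j, 0 < K * S.wordSum j u := fun j =>
    mul_pos (by linarith) (S.wordSum_pos j hu)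
  -- Multiplying by `K` makes the word sums exactly submultiplicative. By Fekete's lemma one
  -- negative value of `log / k` then forces all late values to be negative.
  have hsa : Subadditive fun j => Real.log (K * S.wordSum j u) := by
    intro i j
    rw [← Real.log_mul (hpos i).ne' (hpos j).ne']
    refine Real.log_le_log (hpos _) ?_
    have := hsub u hu i j
    calc _ ≤ K * (K * (S.wordSum i u * S.wordSum j u)) := by gcongr
      _ = _ := by ring
  have hneg : Real.log (K * S.wordSum k u) / k < 0 :=
    div_neg_of_neg_of_pos (Real.log_neg (hpos k) hKW) (by positivity)
  filter_upwards [hsa.eventually_div_lt_of_div_lt hk0 hneg, eventually_ne_atTop 0] with j hj hj0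
  rw [S.levelDimension_lt_iff hj0 hu]
  have h1 : Real.log (K * S.wordSum j u) < 0 := by
    by_contra! hge
    exact absurd hj (not_lt.2 (div_nonneg hge (by positivity)))
  have h2 := (Real.log_neg_iff (hpos j)).1 h1
  exact (le_mul_of_one_le_left (S.wordSum_pos j hu).le hK).trans_lt h2

/-- A bounded sequence that cannot oscillate across any pair `t < u` converges. Length `0` is set
aside throughout: its word sum is `1` at every `t ≥ 0`, so it determines no dimension. -/
theorem tendsto_levelDimension :
    Tendsto S.levelDimension atTop (𝓝 S.affinityDimension) := by
  refine tendsto_nhds_limUnder (tendsto_of_no_upcrossings dense_univ ?_ ?_ ?_)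
  · rintro t - u - htu ⟨h1, h2⟩
    exact h2 ((S.eventually_levelDimension_lt htu h1).mono fun k hk => hk.le.not_gt)
  · obtain ⟨u, hu0, hu⟩ := S.exists_wordSum_lt_one
    refine isBoundedUnder_of_eventually_le (a := u) ?_
    filter_upwards [eventually_ne_atTop 0] with k hk
    exact ((S.levelDimension_lt_iff hk hu0).2 (hu k hk)).le
  · refine isBoundedUnder_of_eventually_ge (a := 0) ?_
    filter_upwards [eventually_ne_atTop 0] with k hk
    exact (S.levelDimension_spec hk).1

theorem affinityDimension_nonneg : 0 ≤ S.affinityDimension := by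
  refine ge_of_tendsto S.tendsto_levelDimension ?_
  filter_upwards [eventually_ne_atTop 0] with k hk
  exact (S.levelDimension_spec hk).1

/-- At some `u` strictly between `s` and `t` the late word sums are below `1`; passing from `u` to
`t` gains the geometric factor `c ^ (k * (t - u))`. -/
theorem summable_wordSum {t : ℝ} (ht : S.affinityDimension < t) :
    Summable fun k => S.wordSum k t := by
  obtain ⟨u, hsu, hut⟩ := exists_between ht
  obtain ⟨c, hc0, hc1, hc⟩ := S.exists_contraction_ratio
  have hu0 : 0 ≤ u := S.affinityDimension_nonneg.trans hsu.le
  have hgeo : Summable fun k : ℕ => (c ^ (u - t) )⁻¹ ^ k := by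
    refine summable_geometric_of_lt_one (by positivity) ?_
    rw [← Real.rpow_neg hc0.le]
    exact Real.rpow_lt_one hc0.le hc1 (by linarith)
  refine Summable.of_norm_bounded_eventually_nat hgeo ?_
  filter_upwards [S.tendsto_levelDimension.eventually_lt_const hsu, eventually_ne_atTop 0]
    with k hk hk0
  rw [Real.norm_of_nonneg (S.wordSum_pos k (hu0.trans hut.le)).le]
  refine (S.wordSum_le_rpow_mul hc0 hc k hu0 hut.le).trans ?_
  have h1 := ((S.levelDimension_lt_iff hk0 hu0).1 hk).le
  calc _ ≤ (c ^ k) ^ (t - u) * 1 := by gcongr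
    _ = _ := by
      rw [mul_one, ← Real.rpow_neg hc0.le, neg_sub, ← Real.rpow_natCast, ← Real.rpow_mul hc0.le,
        ← Real.rpow_natCast, ← Real.rpow_mul hc0.le, mul_comm]

end AffineIFS

/-! ### Coverings by balls -/

/-- `F` is covered by at most `M` closed balls of radius `δ`. -/
def IsBallCoverable {n : ℕ} (δ : ℝ) (F : Set (EuclideanSpace ℝ (Fin n))) (M : ℝ) : Prop :=
  ∃ P : Finset (EuclideanSpace ℝ (Fin n)), (P.card : ℝ) ≤ M ∧ F ⊆ ⋃ p ∈ P, Metric.closedBall p δ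

namespace IsBallCoverable

variable {n : ℕ} {δ M : ℝ} {F : Set (EuclideanSpace ℝ (Fin n))}

theorem mono {δ' M' : ℝ} {F' : Set (EuclideanSpace ℝ (Fin n))} (h : IsBallCoverable δ F M)
    (hδ : δ ≤ δ') (hF : F' ⊆ F) (hM : M ≤ M') : IsBallCoverable δ' F' M' := by
  obtain ⟨P, hP, hPF⟩ := h
  exact ⟨P, hP.trans hM, hF.trans (hPF.trans
    (Set.iUnion₂_mono fun p _ => Metric.closedBall_subset_closedBall hδ))⟩

theorem empty (hM : 0 ≤ M) : IsBallCoverable δ (∅ : Set (EuclideanSpace ℝ (Fin n))) M :=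
  ⟨∅, by simpa using hM, by simp⟩

theorem closedBall (p : EuclideanSpace ℝ (Fin n)) :
    IsBallCoverable δ (Metric.closedBall p δ) 1 :=
  ⟨{p}, by simp, by simp⟩

theorem biUnion {ι : Type*} (s : Finset ι) {F : ι → Set (EuclideanSpace ℝ (Fin n))} {M : ι → ℝ}
    (h : ∀ i ∈ s, IsBallCoverable δ (F i) (M i)) :
    IsBallCoverable δ (⋃ i ∈ s, F i) (∑ i ∈ s, M i) := by
  classical
  induction s using Finset.induction_on with
  | empty => simpa using empty le_rfl
  | insert a s ha ih =>
    obtain ⟨P, hP, hPF⟩ := h a (Finset.mem_insert_self a s)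
    obtain ⟨Q, hQ, hQF⟩ := ih fun i hi => h i (Finset.mem_insert_of_mem hi)
    refine ⟨P ∪ Q, ?_, ?_⟩
    · rw [Finset.sum_insert ha]
      exact (Nat.cast_le.2 (Finset.card_union_le P Q)).trans (by push_cast; linarith)
    · rw [Finset.set_biUnion_insert, Finset.set_biUnion_union]
      exact Set.union_subset_union hPF hQF

theorem iUnion {ι : Type*} [Fintype ι] {F : ι → Set (EuclideanSpace ℝ (Fin n))} {M : ι → ℝ}
    (h : ∀ i, IsBallCoverable δ (F i) (M i)) :
    IsBallCoverable δ (⋃ i, F i) (∑ i, M i) := by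
  simpa using biUnion Finset.univ fun i _ => h i

theorem of_isCompact (hF : IsCompact F) (hδ : 0 < δ) : ∃ M, IsBallCoverable δ F M := by
  obtain ⟨t, -, ht, htF⟩ := hF.finite_cover_balls hδ
  refine ⟨_, ht.toFinset, le_rfl, htF.trans ?_⟩
  simpa using Set.iUnion₂_mono fun p _ => Metric.ball_subset_closedBall

/-- The image of a covered set under a map with linear part `T`. -/
theorem image {ε r L : ℝ} (hF : IsBallCoverable r F L)
    {g : EuclideanSpace ℝ (Fin n) → EuclideanSpace ℝ (Fin n)}
    {T : EuclideanSpace ℝ (Fin n) →ₗ[ℝ] EuclideanSpace ℝ (Fin n)}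
    (hg : ∀ x y, g x - g y = T (x - y))
    (hT : IsBallCoverable ε (T '' Metric.closedBall 0 r) M) :
    IsBallCoverable ε (g '' F) (L * M) := by
  classical
  obtain ⟨P, hP, hPF⟩ := hF
  obtain ⟨Q, hQ, hQT⟩ := hT
  refine ⟨(P ×ˢ Q).image fun pq => g pq.1 + pq.2, ?_, ?_⟩
  · refine (Nat.cast_le.2 Finset.card_image_le).trans ?_
    rw [Finset.card_product, Nat.cast_mul]
    exact mul_le_mul hP hQ (Nat.cast_nonneg _) ((Nat.cast_nonneg _).trans hP)
  · rintro _ ⟨x, hx, rfl⟩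
    obtain ⟨p, hp, hxp⟩ := Set.mem_iUnion₂.1 (hPF hx)
    have h1 : x - p ∈ Metric.closedBall (0 : EuclideanSpace ℝ (Fin n)) r := by
      rwa [mem_closedBall_zero_iff, ← dist_eq_norm]
    obtain ⟨q, hq, hqx⟩ := Set.mem_iUnion₂.1 (hQT ⟨x - p, h1, rfl⟩)
    refine Set.mem_iUnion₂.2 ⟨g p + q, Finset.mem_image.2 ⟨(p, q), by simp [hp, hq], rfl⟩, ?_⟩
    rw [Metric.mem_closedBall, dist_eq_norm] at hqx ⊢
    rwa [← hg, sub_sub] at hqx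

theorem box (hδ : 0 < δ) (f : OrthonormalBasis (Fin n) ℝ (EuclideanSpace ℝ (Fin n)))
    {a : Fin n → ℝ} (ha : ∀ j, 0 ≤ a j) :
    IsBallCoverable (√n * δ) {x | ∀ j, |inner ℝ (f j) x| ≤ a j} (∏ j, (a j / δ + 1)) := by
  classical
  -- Cut each side `[-a j, a j]` into intervals of length `2 * δ` starting at `-a j`; the centres
  -- are the midpoints, so every coordinate is off by at most `δ`.
  refine ⟨(Fintype.piFinset fun j => Finset.range (⌊a j / δ⌋₊ + 1)).image
    fun i => ∑ j, (-a j + (2 * (i j : ℝ) + 1) * δ) • f j, ?_, ?_⟩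
  · refine (Nat.cast_le.2 Finset.card_image_le).trans ?_
    rw [Fintype.card_piFinset, Nat.cast_prod]
    refine Finset.prod_le_prod (fun _ _ => Nat.cast_nonneg _) fun j _ => ?_
    rw [Finset.card_range]
    push_cast
    gcongr
    exact Nat.floor_le (div_nonneg (ha j) hδ.le)
  · intro x hx
    let i : Fin n → ℕ := fun j => ⌊(inner ℝ (f j) x + a j) / (2 * δ)⌋₊
    refine Set.mem_iUnion₂.2 ⟨_, Finset.mem_image.2 ⟨i, ?_, rfl⟩, ?_⟩
    · rw [Fintype.mem_piFinset]
      intro j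
      rw [Finset.mem_range, Nat.lt_succ_iff]
      refine Nat.floor_le_floor ?_
      rw [div_le_div_iff₀ (by positivity) hδ]
      have := (abs_le.1 (hx j)).2
      nlinarith
    · rw [Metric.mem_closedBall, dist_eq_norm]
      refine le_of_sq_le_sq ?_ (by positivity)
      rw [← f.sum_sq_norm_inner_right, mul_pow, Real.sq_sqrt (Nat.cast_nonneg n)]
      have : ∀ j, ‖inner ℝ (f j) (x - ∑ j, (-a j + (2 * (i j : ℝ) + 1) * δ) • f j)‖ ^ 2 ≤ δ ^ 2 := by
        intro j
        rw [inner_sub_right, f.orthonormal.inner_right_fintype]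
        refine pow_le_pow_left₀ (norm_nonneg _) ?_ 2
        have h0 : 0 ≤ (inner ℝ (f j) x + a j) / (2 * δ) :=
          div_nonneg (by linarith [(abs_le.1 (hx j)).1]) (by positivity)
        have h1 := Nat.floor_le h0
        have h2 := (Nat.lt_floor_add_one ((inner ℝ (f j) x + a j) / (2 * δ))).le
        rw [le_div_iff₀ (by positivity)] at h1
        rw [div_le_iff₀ (by positivity)] at h2
        rw [Real.norm_eq_abs, abs_le]
        constructor
        · linarith
        · linarith
      refine (Finset.sum_le_sum fun j _ => this j).trans ?_
      simp

theorem image_closedBall (hδ : 0 < δ)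
    {T : EuclideanSpace ℝ (Fin n) →ₗ[ℝ] EuclideanSpace ℝ (Fin n)} (hT : Function.Injective T)
    {r : ℝ} (hr : 0 ≤ r) :
    IsBallCoverable (√n * δ) (T '' Metric.closedBall 0 r)
      (∏ j ∈ Finset.range n, (r * T.singularValues j / δ + 1)) := by
  obtain ⟨e, f, hef⟩ := LinearMap.exists_singular_bases hT
  rw [Finset.prod_range]
  refine (box hδ f (a := fun j => r * T.singularValues j)
    fun j => mul_nonneg hr (T.singularValues_nonneg j)).mono le_rfl ?_ le_rfl
  rintro _ ⟨x, hx, rfl⟩ j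
  rw [mem_closedBall_zero_iff] at hx
  have h1 : T x = ∑ i, (inner ℝ (e i) x * T.singularValues i) • f i := by
    conv_lhs => rw [← e.sum_repr' x, map_sum]
    simp [hef, mul_smul]
  rw [h1, f.orthonormal.inner_right_fintype, abs_mul, abs_of_nonneg (T.singularValues_nonneg j)]
  refine mul_le_mul_of_nonneg_right ?_ (T.singularValues_nonneg j)
  refine (abs_real_inner_le_norm _ _).trans ?_
  simpa using hx

/-- In the directions `j < m` the count is at most `(D + 1) * α_j / α_m`, and in each remaining
direction at most `D + 1`. -/
theorem image_closedBall_of_le (hδ : 0 < δ)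
    {T : EuclideanSpace ℝ (Fin n) →ₗ[ℝ] EuclideanSpace ℝ (Fin n)} (hT : Function.Injective T)
    {r D : ℝ} (hr : 0 ≤ r) (hD : 0 ≤ D) {m : ℕ} (hm : m < n)
    (hrD : r * T.singularValues m ≤ D * δ) :
    IsBallCoverable (√n * δ) (T '' Metric.closedBall 0 r)
      ((D + 1) ^ n * (LinearMap.singularProd m T / T.singularValues m ^ m)) := by
  refine (image_closedBall hδ hT hr).mono le_rfl le_rfl ?_
  have hα := LinearMap.singularValues_pos_of_injective hT hm
  have h0 : ∀ j, 0 ≤ r * T.singularValues j / δ + 1 := fun j => by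
    have := T.singularValues_nonneg j
    positivity
  have h1 : ∀ j ∈ Finset.range m,
      r * T.singularValues j / δ + 1 ≤ (D + 1) * (T.singularValues j / T.singularValues m) := by
    intro j hj
    have hjm := T.singularValues_antitone (Finset.mem_range.1 hj).le
    have h2 : r / δ ≤ D / T.singularValues m := by
      rwa [div_le_div_iff₀ hδ hα]
    have h3 : 1 ≤ T.singularValues j / T.singularValues m := (one_le_div hα).2 hjm
    calc r * T.singularValues j / δ + 1 = r / δ * T.singularValues j + 1 := by ring
      _ ≤ D / T.singularValues m * T.singularValues j + T.singularValues j / T.singularValues m :=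
        add_le_add (mul_le_mul_of_nonneg_right h2 (T.singularValues_nonneg j)) h3
      _ = _ := by ring
  have h2 : ∀ j ∈ Finset.Ico m n, r * T.singularValues j / δ + 1 ≤ D + 1 := by
    intro j hj
    have hjm := T.singularValues_antitone (Finset.mem_Ico.1 hj).1
    gcongr
    rw [div_le_iff₀ hδ]
    exact (mul_le_mul_of_nonneg_left hjm hr).trans hrD
  rw [← Finset.prod_range_mul_prod_Ico _ hm.le]
  refine (mul_le_mul (Finset.prod_le_prod (fun j _ => h0 j) h1)
    (Finset.prod_le_prod (fun j _ => h0 j) h2) (Finset.prod_nonneg fun j _ => h0 j)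
    (Finset.prod_nonneg fun j _ => mul_nonneg (by positivity)
      (div_nonneg (T.singularValues_nonneg j) hα.le))).trans_eq ?_
  rw [Finset.prod_mul_distrib, Finset.prod_div_distrib]
  simp only [Finset.prod_const, Finset.card_range, Nat.card_Ico, LinearMap.singularProd]
  rw [mul_right_comm, ← pow_add, Nat.add_sub_cancel' hm.le]

end IsBallCoverable

/-! ### Hypercubes and upper box dimension -/

section boxDimension

variable {n : ℕ} {δ : ℝ} {F : Set (EuclideanSpace ℝ (Fin n))}

theorem exists_isHypercube_closedBall_subset (p : EuclideanSpace ℝ (Fin n)) (δ : ℝ) :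
    ∃ Q, IsHypercube δ Q ∧ Metric.closedBall p (δ / 2) ⊆ Q := by
  let c : EuclideanSpace ℝ (Fin n) := p - WithLp.toLp 2 fun _ => δ / 2
  refine ⟨_, ⟨IsometryEquiv.addRight c, rfl⟩, fun x hx => ⟨x - c, fun i => ?_, by simp⟩⟩
  have h1 : |x i - p i| ≤ δ / 2 := by
    rw [Metric.mem_closedBall, dist_eq_norm] at hx
    exact (PiLp.norm_apply_le (x - p) i).trans hx
  have h2 : (x - c) i = x i - p i + δ / 2 := by
    simp [c]
    ring
  rw [h2]
  constructor <;> linarith [(abs_le.1 h1).1, (abs_le.1 h1).2]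

theorem IsHypercube.exists_subset_closedBall {Q : Set (EuclideanSpace ℝ (Fin n))} (hδ : 0 ≤ δ)
    (hQ : IsHypercube δ Q) : ∃ p, Q ⊆ Metric.closedBall p (√n * δ) := by
  obtain ⟨g, rfl⟩ := hQ
  refine ⟨g 0, ?_⟩
  rintro _ ⟨x, hx, rfl⟩
  rw [Metric.mem_closedBall, g.isometry.dist_eq, dist_zero_right]
  refine le_of_sq_le_sq ?_ (by positivity)
  rw [EuclideanSpace.norm_sq_eq, mul_pow, Real.sq_sqrt (Nat.cast_nonneg n)]
  have : ∀ i, ‖x i‖ ^ 2 ≤ δ ^ 2 := fun i =>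
    pow_le_pow_left₀ (norm_nonneg _) (by rw [Real.norm_of_nonneg (hx i).1]; exact (hx i).2) 2
  refine (Finset.sum_le_sum fun i _ => this i).trans ?_
  simp

theorem exists_isHypercube_cover {P : Finset (EuclideanSpace ℝ (Fin n))}
    (hP : F ⊆ ⋃ p ∈ P, Metric.closedBall p (δ / 2)) :
    P.card ∈ {k : ℕ | ∃ Q : Fin k → Set (EuclideanSpace ℝ (Fin n)),
      (∀ j, IsHypercube δ (Q j)) ∧ F ⊆ ⋃ j, Q j} := by
  choose Q hQ hQs using fun p : EuclideanSpace ℝ (Fin n) => exists_isHypercube_closedBall_subset p δ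
  refine ⟨fun j => Q (P.equivFin.symm j), fun j => hQ _, fun x hx => ?_⟩
  obtain ⟨p, hp, hxp⟩ := Set.mem_iUnion₂.1 (hP hx)
  refine Set.mem_iUnion.2 ⟨P.equivFin ⟨p, hp⟩, ?_⟩
  simpa using hQs p hxp

theorem IsBallCoverable.cubeCoveringNumber_le {M : ℝ} (h : IsBallCoverable (δ / 2) F M) :
    (cubeCoveringNumber δ F : ℝ) ≤ M := by
  obtain ⟨P, hP, hPF⟩ := h
  exact (Nat.cast_le.2 (Nat.sInf_le (exists_isHypercube_cover hPF))).trans hP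

theorem exists_cover_cubeCoveringNumber (hF : IsCompact F) (hδ : 0 < δ) :
    ∃ Q : Fin (cubeCoveringNumber δ F) → Set (EuclideanSpace ℝ (Fin n)),
      (∀ j, IsHypercube δ (Q j)) ∧ F ⊆ ⋃ j, Q j := by
  obtain ⟨M, P, -, hP⟩ := IsBallCoverable.of_isCompact hF (half_pos hδ)
  exact Nat.sInf_mem ⟨_, exists_isHypercube_cover hP⟩

theorem isBallCoverable_cubeCoveringNumber (hF : IsCompact F) (hδ : 0 < δ) :
    IsBallCoverable (√n * δ) F (cubeCoveringNumber δ F) := by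
  obtain ⟨Q, hQ, hFQ⟩ := exists_cover_cubeCoveringNumber hF hδ
  choose p hp using fun j => (hQ j).exists_subset_closedBall hδ.le
  have := IsBallCoverable.iUnion (F := Q) (M := fun _ => 1)
    fun j => (IsBallCoverable.closedBall (p j)).mono le_rfl (hp j) le_rfl
  exact this.mono le_rfl hFQ (by simp)

theorem cubeCoveringNumber_mono {F' : Set (EuclideanSpace ℝ (Fin n))} (hF' : IsCompact F')
    (hFF' : F ⊆ F') (hδ : 0 < δ) : cubeCoveringNumber δ F ≤ cubeCoveringNumber δ F' := by
  obtain ⟨Q, hQ, hFQ⟩ := exists_cover_cubeCoveringNumber hF' hδ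
  exact Nat.sInf_le ⟨Q, hQ, hFF'.trans hFQ⟩

theorem eventually_mem_Ioo_zero {r : ℝ} (hr : 0 < r) : ∀ᶠ δ : ℝ in 𝓝[>] 0, δ ∈ Set.Ioo 0 r :=
  Ioo_mem_nhdsGT hr

theorem upperBoxDim_mono {F' : Set (EuclideanSpace ℝ (Fin n))} (hF' : IsCompact F')
    (hFF' : F ⊆ F') : upperBoxDim F ≤ upperBoxDim F' := by
  refine limsup_le_limsup ?_
  filter_upwards [eventually_mem_Ioo_zero one_pos] with δ hδ
  rw [EReal.coe_le_coe_iff]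
  have hlog : 0 < -Real.log δ := neg_pos.2 (Real.log_neg hδ.1 hδ.2)
  refine div_le_div_of_nonneg_right ?_ hlog.le
  rcases Nat.eq_zero_or_pos (cubeCoveringNumber δ F) with h | h
  · rw [h]
    simpa using Real.log_natCast_nonneg _
  · exact Real.log_le_log (by exact_mod_cast h)
      (by exact_mod_cast cubeCoveringNumber_mono hF' hFF' hδ.1)

theorem upperBoxDim_le_of_eventually_le {t L : ℝ}
    (h : ∀ᶠ δ : ℝ in 𝓝[>] 0, (cubeCoveringNumber δ F : ℝ) ≤ L * δ ^ (-t)) (ht : 0 ≤ t) :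
    upperBoxDim F ≤ t := by
  refine EReal.le_of_forall_lt_iff_le.1 fun z hz => ?_
  rw [EReal.coe_lt_coe_iff] at hz
  refine limsup_le_of_le (by isBoundedDefault) ?_
  -- For small `δ` the slack `(z - t) * (-log δ)` absorbs the logarithm of the constant.
  have hlim : ∀ᶠ δ : ℝ in 𝓝[>] 0, Real.log (max L 1) / (z - t) < -Real.log δ :=
    (tendsto_neg_atBot_atTop.comp Real.tendsto_log_nhdsGT_zero).eventually_gt_atTop _
  filter_upwards [h, hlim, eventually_mem_Ioo_zero one_pos] with δ h1 h2 hδ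
  rw [EReal.coe_le_coe_iff]
  have hlog : 0 < -Real.log δ := neg_pos.2 (Real.log_neg hδ.1 hδ.2)
  rw [div_le_iff₀ hlog]
  rw [div_lt_iff₀ (sub_pos.2 hz)] at h2
  rcases Nat.eq_zero_or_pos (cubeCoveringNumber δ F) with h0 | h0
  · rw [h0]
    simpa using mul_nonneg (ht.trans hz.le) hlog.le
  · have h3 : Real.log (cubeCoveringNumber δ F) ≤ Real.log (max L 1 * δ ^ (-t)) := by
      refine Real.log_le_log (by exact_mod_cast h0) (h1.trans ?_)
      have := Real.rpow_pos_of_pos hδ.1 (-t)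
      gcongr
      exact le_max_left _ _
    rw [Real.log_mul (by positivity) (Real.rpow_pos_of_pos hδ.1 _).ne', Real.log_rpow hδ.1] at h3
    linarith

/-- The limsup controls small scales only. At the remaining radii up to `1` one fixed finite cover
serves, since `r ^ (-t) ≥ 1`. Uniformity in `r` matters because copies of `C` are covered at scales
`δ / α_m` anywhere in `(0, 1]`. -/
theorem exists_isBallCoverable_of_upperBoxDim_lt [NeZero n] (hF : IsCompact F) {t : ℝ} (ht : 0 ≤ t)
    (h : upperBoxDim F < t) :
    ∃ L : ℝ, 0 ≤ L ∧ ∀ r : ℝ, 0 < r → r ≤ 1 → IsBallCoverable r F (L * r ^ (-t)) := by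
  have hn : 0 < √(n : ℝ) := Real.sqrt_pos.2 (by exact_mod_cast NeZero.pos n)
  have h1 := (eventually_lt_of_limsup_lt h).and (eventually_mem_Ioo_zero one_pos)
  obtain ⟨δ₀, hδ₀, hδ⟩ := (mem_nhdsGT_iff_exists_Ioo_subset (α := ℝ)).1 h1
  obtain ⟨M, hM⟩ := IsBallCoverable.of_isCompact hF (mul_pos hn (show (0 : ℝ) < δ₀ from hδ₀))
  refine ⟨max (√n ^ t) (max M 0), by positivity, fun r hr0 hr1 => ?_⟩
  have hrpos := Real.rpow_pos_of_pos hr0 (-t)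
  rcases lt_or_ge (r / √n) δ₀ with hr | hr
  · have hr' : 0 < r / √n := by positivity
    obtain ⟨h2, -, h3⟩ := hδ ⟨hr', hr⟩
    rw [EReal.coe_lt_coe_iff, div_lt_iff₀ (neg_pos.2 (Real.log_neg hr' h3))] at h2
    have h4 : (cubeCoveringNumber (r / √n) F : ℝ) ≤ (r / √n) ^ (-t) := by
      rcases Nat.eq_zero_or_pos (cubeCoveringNumber (r / √n) F) with h0 | h0
      · rw [h0]
        simpa using Real.rpow_nonneg hr'.le _
      · rw [← Real.log_le_log_iff (by exact_mod_cast h0) (Real.rpow_pos_of_pos hr' _),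
          Real.log_rpow hr']
        linarith
    refine (isBallCoverable_cubeCoveringNumber hF hr').mono ?_ le_rfl (h4.trans ?_)
    · exact (mul_div_cancel₀ r hn.ne').le
    · rw [Real.div_rpow hr0.le hn.le, Real.rpow_neg hn.le, div_inv_eq_mul, mul_comm]
      gcongr
      exact le_max_left _ _
  · refine hM.mono ?_ le_rfl ?_
    · rw [mul_comm]
      exact (le_div_iff₀ hn).1 hr
    · have h2 : 1 ≤ r ^ (-t) := Real.one_le_rpow_of_pos_of_le_one_of_nonpos hr0 hr1 (by linarith)
      calc M ≤ max M 0 * 1 := by rw [mul_one]; exact le_max_left _ _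
        _ ≤ max M 0 * r ^ (-t) := by gcongr
        _ ≤ _ := mul_le_mul_of_nonneg_right (le_max_right _ _) hrpos.le

end boxDimension

/-! ### Stopped words and the covering of the attractor -/

namespace LinearMap

/-- Write `A = (A ∘ B) ∘ B⁻¹` and bound the product of `m + 1` singular values of `A`, then that of
`m` singular values of `A ∘ B`; dividing by the product of `m` singular values of `A` leaves the
`m`-th ones. -/
theorem exists_mul_singularValues_le_comp {n m : ℕ} (hm : m < n)
    (B : EuclideanSpace ℝ (Fin n) ≃ₗ[ℝ] EuclideanSpace ℝ (Fin n)) :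
    ∃ b : ℝ, 0 < b ∧ ∀ A : EuclideanSpace ℝ (Fin n) →ₗ[ℝ] EuclideanSpace ℝ (Fin n),
      Function.Injective A →
        b * A.singularValues m ≤ (A ∘ₗ B.toLinearMap).singularValues m := by
  obtain ⟨K, hK, h⟩ := exists_singularProd_comp_le n
  have hB : Function.Injective B.toLinearMap := B.injective
  have hB' : Function.Injective B.symm.toLinearMap := B.symm.injective
  have hp := singularProd_pos hm.le hB
  have hp' := singularProd_pos (m := m + 1) hm hB'
  refine ⟨(K * K * (singularProd (m + 1) B.symm.toLinearMap * singularProd m B.toLinearMap))⁻¹,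
    by positivity, fun A hA => ?_⟩
  rw [inv_mul_le_iff₀ (by positivity)]
  have hAB : Function.Injective (A ∘ₗ B.toLinearMap) := hA.comp hB
  have h1 := h (m + 1) hm _ _ hAB hB'
  rw [LinearMap.comp_assoc, LinearEquiv.comp_symm, LinearMap.comp_id,
    singularProd_succ, singularProd_succ] at h1
  have h2 := h m hm.le _ _ hA hB
  have hα := (A ∘ₗ B.toLinearMap).singularValues_nonneg m
  refine le_of_mul_le_mul_left ?_ (singularProd_pos hm.le hA)
  calc _ ≤ _ := h1
    _ ≤ K * (K * (singularProd m A * singularProd m B.toLinearMap) *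
          (A ∘ₗ B.toLinearMap).singularValues m *
          singularProd (m + 1) B.symm.toLinearMap) := by gcongr
    _ = _ := by ring

end LinearMap

namespace AffineIFS

variable {n N : ℕ} (S : AffineIFS n N)

theorem wordLinear_append_one {k : ℕ} (w : Fin k → Fin N) (i : Fin N) :
    S.wordLinear (Fin.append w fun _ : Fin 1 => i) =
      S.wordLinear w ∘ₗ (S.map i).linear.toLinearMap := by
  rw [wordLinear_append, wordLinear, wordLinear, wordMap_one]

theorem wordMap_append_one_image {k : ℕ} (w : Fin k → Fin N) (i : Fin N)
    (F : Set (EuclideanSpace ℝ (Fin n))) :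
    S.wordMap (Fin.append w fun _ : Fin 1 => i) '' F = S.wordMap w '' (S.map i '' F) := by
  rw [wordMap_append, wordMap_one, Set.image_image]
  rfl

theorem one_le_singularValues_wordLinear_zero (w : Fin 0 → Fin N) {m : ℕ} (hm : m < n) :
    1 ≤ (S.wordLinear w).singularValues m := by
  obtain ⟨e, f, hef⟩ := LinearMap.exists_singular_bases (S.wordLinear_injective w)
  have h1 : S.wordLinear w (e ⟨m, hm⟩) = e ⟨m, hm⟩ := by
    rw [wordLinear, wordMap_zero]
    rfl
  have h2 := congrArg norm (hef ⟨m, hm⟩)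
  rw [h1, norm_smul] at h2
  simp [abs_of_nonneg ((S.wordLinear w).singularValues_nonneg m)] at h2
  exact h2.le

theorem exists_mul_singularValues_le_append [NeZero N] {m : ℕ} (hm : m < n) :
    ∃ b : ℝ, 0 < b ∧ ∀ (k : ℕ) (w : Fin k → Fin N) (i : Fin N),
      b * (S.wordLinear w).singularValues m ≤
        (S.wordLinear (Fin.append w fun _ : Fin 1 => i)).singularValues m := by
  choose b hb0 hb using fun i =>
    LinearMap.exists_mul_singularValues_le_comp hm (S.map i).linear
  obtain ⟨i₀, hi₀⟩ := Finite.exists_min b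
  refine ⟨b i₀, hb0 i₀, fun k w i => ?_⟩
  rw [wordLinear_append_one]
  exact (mul_le_mul_of_nonneg_right (hi₀ i) ((S.wordLinear w).singularValues_nonneg m)).trans
    (hb i _ (S.wordLinear_injective w))

open Classical in
/-- The piece of an attractor `F` with condensation set `C` belonging to a word `w`: the copy of `C`
if the `m`-th singular value of `w` is at least `δ`, the copy of `F` if it is in `[b * δ, δ)`. -/
noncomputable def wordPiece (C F : Set (EuclideanSpace ℝ (Fin n))) (m : ℕ) (b δ : ℝ) {k : ℕ}
    (w : Fin k → Fin N) : Set (EuclideanSpace ℝ (Fin n)) :=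
  if δ ≤ (S.wordLinear w).singularValues m then S.wordMap w '' C
  else if b * δ ≤ (S.wordLinear w).singularValues m then S.wordMap w '' F else ∅

variable {S} {C F : Set (EuclideanSpace ℝ (Fin n))}

/-- The preimage of the point under the current word lies in `C`, which ends the descent, or in some
`S_i(F)`, which adds a letter. If that letter takes the singular value below `δ`, the choice of `b`
keeps it at least `b * δ`. -/
theorem IsAttractor.mem_wordPiece_or (hF : S.IsAttractor C F) {m : ℕ} (hm : m < n) {b δ : ℝ}
    (hδ1 : δ ≤ 1) (hb0 : 0 < b) (hb : ∀ (k : ℕ) (w : Fin k → Fin N) (i : Fin N),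
      b * (S.wordLinear w).singularValues m ≤
        (S.wordLinear (Fin.append w fun _ : Fin 1 => i)).singularValues m)
    {x : EuclideanSpace ℝ (Fin n)} (hx : x ∈ F) (k : ℕ) :
    (∃ j ≤ k, ∃ w : Fin j → Fin N, x ∈ S.wordPiece C F m b δ w) ∨
      ∃ w : Fin k → Fin N, δ ≤ (S.wordLinear w).singularValues m ∧ x ∈ S.wordMap w '' F := by
  induction k with
  | zero =>
    refine Or.inr ⟨Fin.elim0, hδ1.trans (S.one_le_singularValues_wordLinear_zero _ hm), x, hx, ?_⟩
    rw [wordMap_zero]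
    rfl
  | succ k ih =>
    rcases ih with ⟨j, hj, w, hw⟩ | ⟨w, hδw, y, hy, rfl⟩
    · exact Or.inl ⟨j, by omega, w, hw⟩
    rw [hF.2.2] at hy
    rcases hy with hy | hy
    · obtain ⟨i, hi⟩ := Set.mem_iUnion.1 hy
      have h1 : S.wordMap w y ∈ S.wordMap (Fin.append w fun _ : Fin 1 => i) '' F := by
        rw [wordMap_append_one_image]
        exact Set.mem_image_of_mem _ hi
      by_cases h : δ ≤ (S.wordLinear (Fin.append w fun _ : Fin 1 => i)).singularValues m
      · exact Or.inr ⟨_, h, h1⟩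
      · refine Or.inl ⟨k + 1, le_rfl, Fin.append w fun _ : Fin 1 => i, ?_⟩
        rw [wordPiece, if_neg h, if_pos]
        · exact h1
        · exact (mul_le_mul_of_nonneg_left hδw hb0.le).trans (hb k w i)
    · refine Or.inl ⟨k, by omega, w, ?_⟩
      rw [wordPiece, if_pos hδw]
      exact Set.mem_image_of_mem _ hy

theorem IsAttractor.subset_iUnion_wordPiece [NeZero N] (hF : S.IsAttractor C F) {m : ℕ}
    (hm : m < n) {b δ : ℝ} (hδ0 : 0 < δ) (hδ1 : δ ≤ 1) (hb0 : 0 < b)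
    (hb : ∀ (k : ℕ) (w : Fin k → Fin N) (i : Fin N),
      b * (S.wordLinear w).singularValues m ≤
        (S.wordLinear (Fin.append w fun _ : Fin 1 => i)).singularValues m) :
    ∃ k : ℕ, F ⊆ ⋃ j ∈ Finset.range k, ⋃ w : Fin j → Fin N, S.wordPiece C F m b δ w := by
  obtain ⟨c, hc0, hc1, hc⟩ := S.exists_contraction_ratio
  obtain ⟨k, hk⟩ := exists_pow_lt_of_lt_one hδ0 hc1
  refine ⟨k + 1, fun x hx => ?_⟩
  -- After `k` letters all singular values are at most `c ^ k < δ`, so every descent has stopped.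
  rcases hF.mem_wordPiece_or hm hδ1 hb0 hb hx k with ⟨j, hj, w, hw⟩ | ⟨w, hδw, -⟩
  · exact Set.mem_iUnion₂.2 ⟨j, Finset.mem_range.2 (by omega), Set.mem_iUnion.2 ⟨w, hw⟩⟩
  · exact absurd (hδw.trans (S.singularValues_wordLinear_le hc0 hc w m)) hk.not_ge

theorem isBallCoverable_wordPiece {m : ℕ} (hm : m < n) {t b δ L R : ℝ} {x₀ : EuclideanSpace ℝ (Fin n)}
    (hδ0 : 0 < δ) (hb0 : 0 < b) (ht : 0 ≤ t) (hL : 0 ≤ L) (hR : 0 ≤ R)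
    (hC : ∀ r : ℝ, 0 < r → r ≤ 1 → IsBallCoverable r C (L * r ^ (-t)))
    (hF : F ⊆ Metric.closedBall x₀ R) {k : ℕ} (w : Fin k → Fin N) :
    IsBallCoverable (√n * δ) (S.wordPiece C F m b δ w)
      ((2 ^ n * L + (R + 1) ^ n * b ^ (-t)) * δ ^ (-t) *
        (LinearMap.singularProd m (S.wordLinear w) *
          (S.wordLinear w).singularValues m ^ (t - m))) := by
  have hT := S.wordLinear_injective w
  have hα := LinearMap.singularValues_pos_of_injective hT hm
  have hP := LinearMap.singularProd_nonneg m (S.wordLinear w)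
  have hδt := Real.rpow_pos_of_pos hδ0 (-t)
  have hαt := Real.rpow_pos_of_pos hα (t - m)
  have hbt := Real.rpow_pos_of_pos hb0 (-t)
  have hsplit : (S.wordLinear w).singularValues m ^ (t - m) =
      (S.wordLinear w).singularValues m ^ t / (S.wordLinear w).singularValues m ^ m := by
    rw [Real.rpow_sub hα, Real.rpow_natCast]
  rw [wordPiece]
  split_ifs with h1 h2
  · have hr : 0 < δ / (S.wordLinear w).singularValues m := by positivity
    refine ((hC _ hr ((div_le_one hα).2 h1)).image (S.wordMap_sub w)
      (IsBallCoverable.image_closedBall_of_le hδ0 hT hr.le zero_le_one hm ?_)).mono le_rfl le_rfl ?_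
    · rw [div_mul_cancel₀ _ hα.ne', one_mul]
    · rw [Real.div_rpow hδ0.le hα.le, Real.rpow_neg hα.le, div_inv_eq_mul]
      calc _ = (2 ^ n * L) * δ ^ (-t) * (LinearMap.singularProd m (S.wordLinear w) *
          (S.wordLinear w).singularValues m ^ (t - m)) := by
            rw [hsplit]
            norm_num
            ring
        _ ≤ _ := by
          gcongr
          exact le_add_of_nonneg_right (by positivity)
  · refine (((IsBallCoverable.closedBall x₀).mono le_rfl hF le_rfl).image (S.wordMap_sub w)
      (IsBallCoverable.image_closedBall_of_le hδ0 hT hR hR hm ?_)).mono le_rfl le_rfl ?_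
    · exact mul_le_mul_of_nonneg_left (not_le.1 h1).le hR
    · have h3 : 1 ≤ b ^ (-t) * δ ^ (-t) * (S.wordLinear w).singularValues m ^ t := by
        rw [← Real.mul_rpow hb0.le hδ0.le, Real.rpow_neg (by positivity), inv_mul_eq_div,
          one_le_div (by positivity)]
        exact Real.rpow_le_rpow (by positivity) h2 ht
      calc _ = (R + 1) ^ n * (LinearMap.singularProd m (S.wordLinear w) /
            (S.wordLinear w).singularValues m ^ m) * 1 := by ring
        _ ≤ (R + 1) ^ n * (LinearMap.singularProd m (S.wordLinear w) /
            (S.wordLinear w).singularValues m ^ m) *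
            (b ^ (-t) * δ ^ (-t) * (S.wordLinear w).singularValues m ^ t) := by gcongr
        _ = ((R + 1) ^ n * b ^ (-t)) * δ ^ (-t) * (LinearMap.singularProd m (S.wordLinear w) *
          (S.wordLinear w).singularValues m ^ (t - m)) := by
            rw [hsplit]
            ring
        _ ≤ _ := by
          gcongr
          exact le_add_of_nonneg_left (by positivity)
  · exact IsBallCoverable.empty (by positivity)

variable [NeZero N]

theorem subset_attractor (S : AffineIFS n N) (C : Compacts (EuclideanSpace ℝ (Fin n))) :
    (C : Set (EuclideanSpace ℝ (Fin n))) ⊆ S.attractor C := by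
  rw [(S.isAttractor_attractor C).2.2]
  exact Set.subset_union_right

/-- The union `F_∅ ∪ F_C` also solves the equation with condensation set `C`, so by uniqueness it
equals `F_C`. -/
theorem attractor_bot_subset (S : AffineIFS n N) (C : Compacts (EuclideanSpace ℝ (Fin n))) :
    S.attractor ⊥ ⊆ S.attractor C := by
  have h0 := S.isAttractor_attractor ⊥
  have hC := S.isAttractor_attractor C
  have h : S.IsAttractor C (S.attractor ⊥ ∪ S.attractor C) := by
    refine ⟨h0.1.inl, h0.2.1.union hC.2.1, ?_⟩
    have h0' := h0.2.2
    rw [Compacts.coe_bot, Set.union_empty] at h0'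
    simp only [Set.image_union, Set.iUnion_union_distrib]
    rw [Set.union_assoc, ← hC.2.2, ← h0']
  rw [← (S.existsUnique_isAttractor C).unique h hC]
  exact Set.subset_union_left

variable [NeZero n]

theorem IsAttractor.upperBoxDim_le (hF : S.IsAttractor C F) (hC : IsCompact C) {t : ℝ}
    (hst : S.affinityDimension < t) (hCt : upperBoxDim C < t) : upperBoxDim F ≤ t := by
  have ht : 0 ≤ t := S.affinityDimension_nonneg.trans hst.le
  have hn : 0 < √(n : ℝ) := Real.sqrt_pos.2 (by exact_mod_cast NeZero.pos n)
  obtain ⟨m, hm, -, hφ⟩ := exists_singularProd_mul_rpow_le n ht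
  obtain ⟨b, hb0, hb⟩ := S.exists_mul_singularValues_le_append hm
  obtain ⟨L, hL, hCL⟩ := exists_isBallCoverable_of_upperBoxDim_lt hC ht hCt
  obtain ⟨R, hR0, hR⟩ := hF.2.1.isBounded.subset_closedBall_lt 0 0
  have hbt := Real.rpow_pos_of_pos hb0 (-t)
  have hsum := S.summable_wordSum hst
  let H := 2 ^ n * L + (R + 1) ^ n * b ^ (-t)
  have hH : 0 ≤ H := by positivity
  have key : ∀ δ : ℝ, 0 < δ → δ ≤ 1 →
      IsBallCoverable (√n * δ) F (H * δ ^ (-t) * ∑' k, S.wordSum k t) := by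
    intro δ hδ0 hδ1
    have hδt := Real.rpow_pos_of_pos hδ0 (-t)
    obtain ⟨k, hk⟩ := hF.subset_iUnion_wordPiece hm hδ0 hδ1 hb0 hb
    refine (IsBallCoverable.biUnion (Finset.range k) fun j _ => IsBallCoverable.iUnion fun w =>
      isBallCoverable_wordPiece hm hδ0 hb0 ht hL hR0.le hCL hR w).mono le_rfl hk ?_
    calc _ ≤ ∑ j ∈ Finset.range k, H * δ ^ (-t) * S.wordSum j t := by
          refine Finset.sum_le_sum fun j _ => ?_
          rw [wordSum_eq, Finset.mul_sum]
          refine Finset.sum_le_sum fun w _ => ?_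
          exact mul_le_mul_of_nonneg_left (hφ _ (S.wordLinear_injective w)) (by positivity)
      _ ≤ _ := by
          rw [← Finset.mul_sum]
          gcongr
          exact hsum.sum_le_tsum _ fun j _ => (S.wordSum_pos j ht).le
  refine upperBoxDim_le_of_eventually_le
    (L := H * (2 * √n) ^ t * ∑' k, S.wordSum k t) ?_ ht
  filter_upwards [eventually_mem_Ioo_zero (show 0 < 2 * √(n : ℝ) by positivity)] with δ hδ
  -- This scale gives balls of radius `δ / 2`, each of which fits into a cube of side `δ`.
  have h1 := key (δ / (2 * √n)) (div_pos hδ.1 (by positivity))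
    ((div_le_one (by positivity)).2 hδ.2.le)
  have h2 : √n * (δ / (2 * √n)) = δ / 2 := by field_simp
  rw [h2] at h1
  refine h1.cubeCoveringNumber_le.trans_eq ?_
  rw [Real.div_rpow hδ.1.le (by positivity), Real.rpow_neg (by positivity : 0 ≤ 2 * √(n : ℝ)),
    div_inv_eq_mul]
  ring

theorem IsAttractor.upperBoxDim_le_max (hF : S.IsAttractor C F) (hC : IsCompact C) :
    upperBoxDim F ≤ max (S.affinityDimension : EReal) (upperBoxDim C) := by
  refine EReal.le_of_forall_lt_iff_le.1 fun t ht => ?_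
  obtain ⟨h1, h2⟩ := max_lt_iff.1 ht
  exact hF.upperBoxDim_le hC (by exact_mod_cast h1) h2

end AffineIFS

theorem corollary2p2 {n N : ℕ} [NeZero n] [NeZero N] (S : AffineIFS n N)
    (C : Compacts (EuclideanSpace ℝ (Fin n))) :
    -- the affinity dimension `s` is well defined
    ((∀ k : ℕ, 1 ≤ k → ∃! t : ℝ, 0 ≤ t ∧ S.wordSum k t = 1) ∧
      Tendsto S.levelDimension atTop (𝓝 S.affinityDimension)) ∧
    (upperBoxDim (S.attractor ⊥) = (S.affinityDimension : EReal) →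
      upperBoxDim (S.attractor C) =
        max (upperBoxDim (S.attractor ⊥)) (upperBoxDim (SetLike.coe C))) ∧
    ((S.affinityDimension : EReal) ≤ upperBoxDim (SetLike.coe C) →
      upperBoxDim (S.attractor C) = upperBoxDim (SetLike.coe C)) := by
  have hF := S.isAttractor_attractor C
  have hle := hF.upperBoxDim_le_max C.isCompact
  have hge := upperBoxDim_mono hF.2.1 (S.subset_attractor C)
  have hge₀ := upperBoxDim_mono hF.2.1 (S.attractor_bot_subset C)
  refine ⟨⟨fun k hk => S.existsUnique_wordSum_eq_one hk, S.tendsto_levelDimension⟩,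
    fun h => ?_, fun h => ?_⟩
  · rw [← h] at hle
    exact le_antisymm hle (max_le hge₀ hge)
  · rw [max_eq_right h] at hle
    exact le_antisymm hle hge
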